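/- For $n$ qubits, let $\mathcal S_n=\{U|0\rangle\langle 0|^{\otimes n}U^\dagger : U\in\mathcal C_n\}$ be the set of pure stabilizer states, where the Clifford group $\mathcal C_n$ consists of the unitaries that normalize the $n$-qubit Pauli group, and let $\mathcal F_n$ (the stabilizer states) be the convex hull of $\mathcal S_n$. For $n=1$, $\mathcal F_1$ is an octahedron, the stabilizer octahedron. A magic state is a density matrix that is not in $\mathcal F_n$. For density matrices, let $S(\rho\Vert\sigma)=\mathrm{Tr}(\rho\log_2\rho)-\mathrm{Tr}(\rho\log_2\sigma)$ if $\mathrm{supp}(\rho)\subseteq\mathrm{supp}(\sigma)$, and $S(\rho\Vert\sigma)=\infty$ otherwise. The relative entropy of magic of an $n$-qubit state $\rho$ is $\mathcal R_{\mathrm{rel}}(\rho)=\inf_{\sigma\in\mathcal F_n}S(\rho\Vert\sigma)$, and a closest stabilizer state to $\rho$ is a $\sigma\in\mathcal F_n$ with $S(\rho\Vert\sigma)=\mathcal R_{\mathrm{rel}}(\rho)$. **Theorem.** Let $\rho^{(1)},\dots,\rho^{(n)}$ be single-qubit magic states, and for each $i$ let $\sigma^{(i)}\in\mathcal F_1$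 be a closest stabilizer state to $\rho^{(i)}$. Suppose that 1. $[\rho^{(i)},\sigma^{(i)}]\neq 0$ for at least two indices $i\in\{1,\dots,n\}$, and 2. at least one $\sigma^{(i)}$ with $[\rho^{(i)},\sigma^{(i)}]\neq 0$ lies in the relative interior of a facet of the stabilizer octahedron $\mathcal F_1$. Then the relative entropy of magic is not additive on $\rho^{(1)}\otimes\cdots\otimes\rho^{(n)}$; more precisely, $$\mathcal R_{\mathrm{rel}}\Big(\bigotimes_{i=1}^n\rho^{(i)}\Big)<\sum_{i=1}^n\mathcal R_{\mathrm{rel}}\big(\rho^{(i)}\big).$$ -/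

import Mathlib

open scoped Matrix ComplexOrder

noncomputable section

namespace Magic

/-- Operators on `n` qubits, as matrices in the computational basis, which is indexed by bit
strings of length `n`. In particular `Op 1` is the space of single-qubit operators. -/
abbrev Op (n : ℕ) : Type := Matrix (Fin n → Fin 2) (Fin n → Fin 2) ℂ

/-- The tensor product `A₁ ⊗ ⋯ ⊗ Aₙ` of single-qubit operators. -/
def tensorProd {n : ℕ} (A : Fin n → Op 1) : Op n :=
  Matrix.of fun j k => ∏ i, A i (fun _ => j i) (fun _ => k i)

/-- The four Pauli matrices `I, X, Y, Z` as `2 × 2` matrices. -/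
def pauliMatrix : Fin 4 → Matrix (Fin 2) (Fin 2) ℂ :=
  ![!![1, 0; 0, 1], !![0, 1; 1, 0], !![0, -Complex.I; Complex.I, 0], !![1, 0; 0, -1]]

/-- The four Pauli matrices as single-qubit operators. -/
def pauli (a : Fin 4) : Op 1 := (pauliMatrix a).submatrix (fun j => j 0) (fun j => j 0)

/-- The `n`-qubit Pauli group: the operators `i ^ k • (P₁ ⊗ ⋯ ⊗ Pₙ)` with Pauli matrices `Pᵢ`. -/
def pauliGroup (n : ℕ) : Set (Op n) :=
  {P | ∃ (k : ℕ) (a : Fin n → Fin 4), P = Complex.I ^ k • tensorProd fun i => pauli (a i)}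

/-- The `n`-qubit Clifford group: the unitaries that map the Pauli group into itself by
conjugation (onto itself, as the Pauli group is finite). -/
def cliffordGroup (n : ℕ) : Set (Op n) :=
  {U | U ∈ Matrix.unitaryGroup (Fin n → Fin 2) ℂ ∧ ∀ P ∈ pauliGroup n, U * P * Uᴴ ∈ pauliGroup n}

/-- The projector onto `|0 ⋯ 0⟩`. -/
def zeroState (n : ℕ) : Op n := Matrix.single 0 0 1

/-- The pure stabilizer states `U |0 ⋯ 0⟩⟨0 ⋯ 0| U†`, `U` in the Clifford group. -/
def pureStabilizerStates (n : ℕ) : Set (Op n) :=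
  {S | ∃ U ∈ cliffordGroup n, S = U * zeroState n * Uᴴ}

/-- The density matrices of `n` qubits. -/
def densityMatrices (n : ℕ) : Set (Op n) := {ρ | ρ.PosSemidef ∧ ρ.trace = 1}

/-- The stabilizer states of `n` qubits: the convex hull of the pure stabilizer states.
For `n = 1` this is the stabilizer octahedron. -/
def stabilizerStates (n : ℕ) : Set (Op n) := convexHull ℝ (pureStabilizerStates n)

/-- The magic states: the density matrices that are not stabilizer states. -/
def magicStates (n : ℕ) : Set (Op n) := densityMatrices n \ stabilizerStates n

/-- The base-two logarithm of a Hermitian matrix by functional calculus. As `Real.logb 2 0 = 0`,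
a positive semidefinite matrix has its logarithm taken on its support. -/
def log2 {n : ℕ} (A : Op n) : Op n := cfc (Real.logb 2) A

open Classical in
/-- The relative entropy `S(ρ ‖ σ) = Tr (ρ log₂ ρ) - Tr (ρ log₂ σ)` if `supp ρ ⊆ supp σ`, and `∞`
otherwise. The support of a Hermitian matrix is its range. -/
def relEntropy {n : ℕ} (ρ σ : Op n) : EReal :=
  if LinearMap.range ρ.mulVecLin ≤ LinearMap.range σ.mulVecLin then
    (((ρ * log2 ρ).trace.re - (ρ * log2 σ).trace.re : ℝ) : EReal)
  else ⊤

/-- The relative entropy of magic. -/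
def relEntropyOfMagic {n : ℕ} (ρ : Op n) : EReal :=
  ⨅ σ ∈ stabilizerStates n, relEntropy ρ σ

/-- `σ` is a closest stabilizer state to `ρ`: it attains the infimum that defines the relative
entropy of magic. -/
def IsClosestStabilizerState {n : ℕ} (ρ σ : Op n) : Prop :=
  σ ∈ stabilizerStates n ∧ relEntropy ρ σ = relEntropyOfMagic ρ

/-- `A` is a facet of the convex set `P`: a nonempty exposed face of codimension one in `P`. -/
def IsFacet {n : ℕ} (P A : Set (Op n)) : Prop :=
  A.Nonempty ∧ IsExposed ℝ P A ∧
    Module.finrank ℝ (vectorSpan ℝ A) + 1 = Module.finrank ℝ (vectorSpan ℝ P)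

end Magic

end

/-! The product of the closest states is a stabilizer state whose relative entropy is the sum of the
single-qubit ones (`trace_tensorProd_mul_cfc_log`), so it suffices to show that this product is not
optimal. It is perturbed in a direction `Δ` with traceless factors `D`, `E` at two noncommuting
sites `p`, `q` and the closest states elsewhere. The perturbed operator is the midpoint of the
products with `(σ p + D, σ q + E)` and `(σ p - D, σ q - E)` at these sites, hence again a stabilizer
state (`tensorProd_add_mem_stabilizerStates`).

The derivative of `Tr (ρ log τ)` along `Δ` is a sum over eigenbasis entries weighted by divided
differences of the logarithm (`hasDerivAt_trace_mul_cfc_log`). All sites but `p` and `q` drop out,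
and stationarity of `σ p` along `D` leaves, up to the factor 2, `Re z * Re w * c₁ + Im z * Im w *
c₂`, where `z` and `w` are the coherences of `D` and `E` (`hasDerivAt_tensorProd`). The constants
`c₁`, `c₂` depend on the eigenvalues only and are nonzero by inequalities for `t / sinh t`
(`dslope_log_mul_ne`).

Noncommutation provides `E` with `w ≠ 0` (`exists_isFeasible_coherence_ne_zero`). In the interior of
a facet, the directions of the facet realize every complex `z` up to a positive scale
(`exists_isFeasible_coherence_eq`), so `z` can be taken along `(Re w * c₁, Im w * c₂)`. The
derivative is then positive, and a small step lowers the relative entropy strictly. -/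

namespace Magic

open Filter Topology

/-! ### Functional calculus in an eigenbasis and the derivative of the matrix logarithm. -/

section Spectral

variable {m : Type*} [Fintype m] [DecidableEq m]

/-- The Hermitian matrix with eigenvectors the columns of `U` and eigenvalues `a`. -/
noncomputable def spectralMatrix (U : Matrix m m ℂ) (a : m → ℝ) : Matrix m m ℂ :=
  U * Matrix.diagonal (fun i => (a i : ℂ)) * Uᴴ

lemma isHermitian_spectralMatrix (U : Matrix m m ℂ) (a : m → ℝ) :
    (spectralMatrix U a).IsHermitian := by
  unfold spectralMatrix Matrix.IsHermitian
  simp only [Matrix.conjTranspose_mul, Matrix.conjTranspose_conjTranspose,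
    Matrix.diagonal_conjTranspose, Matrix.mul_assoc]
  congr 3
  ext i
  simp

lemma conjTranspose_mul_self_of_mem {U : Matrix m m ℂ} (hU : U ∈ Matrix.unitaryGroup m ℂ) :
    Uᴴ * U = 1 := Matrix.mem_unitaryGroup_iff'.1 hU

lemma mul_conjTranspose_self_of_mem {U : Matrix m m ℂ} (hU : U ∈ Matrix.unitaryGroup m ℂ) :
    U * Uᴴ = 1 := Matrix.mem_unitaryGroup_iff.1 hU

/-- The functional calculus is computed in a chosen eigenbasis `V`, not in `U`. The matrix `Uᴴ * V`
intertwines the two diagonals, so each of its nonzero entries joins equal eigenvalues; hence it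
intertwines their images under `f` too. -/
lemma cfc_spectralMatrix {U : Matrix m m ℂ} (hU : U ∈ Matrix.unitaryGroup m ℂ) (a : m → ℝ)
    (f : ℝ → ℝ) : cfc f (spectralMatrix U a) = spectralMatrix U (fun i => f (a i)) := by
  have hA := isHermitian_spectralMatrix U a
  rw [hA.cfc_eq f]
  let V : Matrix m m ℂ := hA.eigenvectorUnitary.1
  have hVU : V ∈ Matrix.unitaryGroup m ℂ := hA.eigenvectorUnitary.2
  let e := hA.eigenvalues
  have h1 : spectralMatrix U a = spectralMatrix V e := hA.spectral_theorem
  change spectralMatrix V (fun i => f (e i)) = _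
  have h2 : Matrix.diagonal (fun i => (a i : ℂ)) * (Uᴴ * V) =
      (Uᴴ * V) * Matrix.diagonal (fun i => (e i : ℂ)) := by
    have := congrArg (fun M => Uᴴ * M * V) h1
    simp only [spectralMatrix] at this
    calc _ = (Uᴴ * U) * Matrix.diagonal (fun i => (a i : ℂ)) * (Uᴴ * V) := by
          rw [conjTranspose_mul_self_of_mem hU, one_mul]
      _ = Uᴴ * (U * Matrix.diagonal (fun i => (a i : ℂ)) * Uᴴ) * V := by
          simp only [mul_assoc]
      _ = Uᴴ * (V * Matrix.diagonal (fun i => (e i : ℂ)) * Vᴴ) * V := this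
      _ = (Uᴴ * V) * Matrix.diagonal (fun i => (e i : ℂ)) * (Vᴴ * V) := by
          simp only [mul_assoc]
      _ = _ := by rw [conjTranspose_mul_self_of_mem hVU, mul_one]
  have h3 : Matrix.diagonal (fun i => (f (a i) : ℂ)) * (Uᴴ * V) =
      (Uᴴ * V) * Matrix.diagonal (fun i => (f (e i) : ℂ)) := by
    ext i j
    have := congrFun (congrFun h2 i) j
    simp only [Matrix.diagonal_mul, Matrix.mul_diagonal] at this ⊢
    by_cases h0 : (Uᴴ * V) i j = 0
    · simp [h0]
    · have h4 : (a i : ℂ) = e j := by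
        rw [mul_comm] at this
        exact mul_left_cancel₀ h0 this
      have h5 : a i = e j := by exact_mod_cast h4
      rw [h5, mul_comm]
  unfold spectralMatrix
  calc V * Matrix.diagonal (fun i => (f (e i) : ℂ)) * Vᴴ
      = U * Uᴴ * V * Matrix.diagonal (fun i => (f (e i) : ℂ)) * Vᴴ := by
        rw [mul_conjTranspose_self_of_mem hU, one_mul]
    _ = U * ((Uᴴ * V) * Matrix.diagonal (fun i => (f (e i) : ℂ))) * Vᴴ := by
        simp only [mul_assoc]
    _ = U * Matrix.diagonal (fun i => (f (a i) : ℂ)) * Uᴴ * (V * Vᴴ) := by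
        rw [← h3]; simp only [mul_assoc]
    _ = _ := by rw [mul_conjTranspose_self_of_mem hVU, mul_one]

lemma trace_mul_spectralMatrix (ρ U : Matrix m m ℂ) (a : m → ℝ) :
    (ρ * spectralMatrix U a).trace = ∑ i, (Uᴴ * ρ * U) i i * a i := by
  have h : ρ * spectralMatrix U a =
      ρ * U * Matrix.diagonal (fun i => (a i : ℂ)) * Uᴴ := by
    simp only [spectralMatrix, mul_assoc]
  rw [h, Matrix.trace_mul_comm]
  simp only [← mul_assoc, Matrix.trace, Matrix.diag, Matrix.mul_diagonal]

/-- The rank-one projector onto a column of `U`. -/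
noncomputable def colProj (U : Matrix m m ℂ) (j : m) : Matrix m m ℂ :=
  spectralMatrix U (fun i => if i = j then 1 else 0)

lemma sum_colProj {U : Matrix m m ℂ} (hU : U ∈ Matrix.unitaryGroup m ℂ) :
    ∑ j, colProj U j = 1 := by
  have h : ∑ j, Matrix.diagonal (fun i => (((if i = j then 1 else 0 : ℝ)) : ℂ)) =
      (1 : Matrix m m ℂ) := by
    ext i k
    simp only [Matrix.sum_apply, Matrix.diagonal_apply, Matrix.one_apply]
    by_cases hik : i = k <;> simp [hik, apply_ite Complex.ofReal]
  simp only [colProj, spectralMatrix, ← Finset.mul_sum, ← Finset.sum_mul]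
  rw [h, mul_one, mul_conjTranspose_self_of_mem hU]

lemma colProj_mul_spectralMatrix {U : Matrix m m ℂ} (hU : U ∈ Matrix.unitaryGroup m ℂ)
    (a : m → ℝ) (j : m) : colProj U j * spectralMatrix U a = (a j : ℂ) • colProj U j := by
  have h : Matrix.diagonal (fun i => (((if i = j then 1 else 0 : ℝ)) : ℂ)) *
      Matrix.diagonal (fun i => (a i : ℂ)) =
      (a j : ℂ) • Matrix.diagonal (fun i => (((if i = j then 1 else 0 : ℝ)) : ℂ)) := by
    ext i k
    simp only [Matrix.diagonal_mul_diagonal, Matrix.diagonal_apply, Matrix.smul_apply]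
    by_cases hik : i = k <;> by_cases hij : i = j <;> simp_all
  unfold colProj spectralMatrix
  calc _ = U * (Matrix.diagonal (fun i => (((if i = j then 1 else 0 : ℝ)) : ℂ)) * (Uᴴ * U) *
        Matrix.diagonal (fun i => (a i : ℂ))) * Uᴴ := by simp only [mul_assoc]
    _ = _ := by
      rw [conjTranspose_mul_self_of_mem hU, mul_one, h]
      simp

lemma trace_mul_colProj_mul (ρ Δ U : Matrix m m ℂ) (j : m) (a : m → ℝ) :
    (ρ * (colProj U j * Δ * spectralMatrix U a)).trace =
      ∑ k, (Uᴴ * ρ * U) k j * (Uᴴ * Δ * U) j k * a k := by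
  have h1 : ρ * (colProj U j * Δ * spectralMatrix U a) =
      (ρ * (colProj U j * Δ)) * spectralMatrix U a := by simp only [mul_assoc]
  rw [h1, trace_mul_spectralMatrix]
  refine Finset.sum_congr rfl fun k _ => ?_
  congr 1
  have h2 : Uᴴ * (ρ * (colProj U j * Δ)) * U = (Uᴴ * ρ * U) *
      (Matrix.diagonal (fun i => (((if i = j then 1 else 0 : ℝ)) : ℂ)) * (Uᴴ * Δ * U)) := by
    simp only [colProj, spectralMatrix, mul_assoc]
  rw [h2, Matrix.mul_apply, Finset.sum_eq_single j]
  · simp [Matrix.diagonal_mul]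
  · intro i _ hi
    simp [Matrix.diagonal_mul, hi]
  · simp

lemma continuousOn_matrix {f : ℝ → ℝ} {A : Matrix m m ℂ} : ContinuousOn f (spectrum ℝ A) :=
  Set.Finite.continuousOn (Matrix.finite_real_spectrum) f

/-- The scalar identity `f x - f b = (x - b) * dslope f b x`, transported by the functional
calculus. -/
lemma cfc_sub_algebraMap_eq_mul_dslope {A : Matrix m m ℂ} (hA : A.IsHermitian) (f : ℝ → ℝ)
    (b : ℝ) : cfc f A - algebraMap ℝ _ (f b) =
      (A - algebraMap ℝ _ b) * cfc (dslope f b) A := by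
  have hA' : IsSelfAdjoint A := hA
  have h1 : cfc (fun x => f x - f b) A = cfc f A - algebraMap ℝ _ (f b) := by
    rw [cfc_sub f (fun _ => f b) A continuousOn_matrix continuousOn_matrix, cfc_const _ A hA']
  have h2 : cfc (fun x => (x - b) * dslope f b x) A =
      (A - algebraMap ℝ _ b) * cfc (dslope f b) A := by
    rw [cfc_mul (fun x => x - b) (dslope f b) A continuousOn_matrix continuousOn_matrix,
      cfc_sub (fun x => x) (fun _ => b) A continuousOn_matrix continuousOn_matrix,
      cfc_id' ℝ A hA', cfc_const _ A hA']
  rw [← h1, ← h2]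
  congr 1
  ext x
  exact (sub_smul_dslope f b x).symm

/-- To the right of the projector `colProj U j` the unperturbed matrix acts as the scalar `a j`, so
the previous factorization with `b = a j` leaves only `Δ`. As the formula is exact, differentiating
at zero needs only continuity of the functional calculus. -/
lemma cfc_add_sub_cfc {U : Matrix m m ℂ} (hU : U ∈ Matrix.unitaryGroup m ℂ) (a : m → ℝ)
    (f : ℝ → ℝ) {Δ : Matrix m m ℂ} (hΔ : Δ.IsHermitian) :
    cfc f (spectralMatrix U a + Δ) - cfc f (spectralMatrix U a) =
      ∑ j, colProj U j * Δ * cfc (dslope f (a j)) (spectralMatrix U a + Δ) := by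
  rw [← one_mul (cfc f (spectralMatrix U a + Δ) - cfc f (spectralMatrix U a)), ← sum_colProj hU,
    Finset.sum_mul]
  refine Finset.sum_congr rfl fun j _ => ?_
  have h := cfc_sub_algebraMap_eq_mul_dslope ((isHermitian_spectralMatrix U a).add hΔ) f (a j)
  have e1 : ∀ r : ℝ, colProj U j * algebraMap ℝ (Matrix m m ℂ) r = (r : ℂ) • colProj U j := by
    intro r
    rw [Algebra.algebraMap_eq_smul_one, mul_smul_comm, mul_one]
    ext; simp
  have h2 : colProj U j * cfc f (spectralMatrix U a) =
      colProj U j * algebraMap ℝ _ (f (a j)) := by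
    rw [cfc_spectralMatrix hU, colProj_mul_spectralMatrix hU, e1]
  have h3 : colProj U j * (spectralMatrix U a + Δ - algebraMap ℝ _ (a j)) = colProj U j * Δ := by
    rw [mul_sub, mul_add, colProj_mul_spectralMatrix hU, e1]
    abel
  rw [mul_sub, h2, ← mul_sub, h, ← mul_assoc, h3]

-- Upper hemicontinuity of the spectrum keeps it inside the open half-line for small `t`, where `f`
-- is continuous.
open scoped Matrix.Norms.L2Operator in
lemma tendsto_cfc_add_smul {A Δ : Matrix m m ℂ} (hA : A.IsHermitian) (hΔ : Δ.IsHermitian)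
    {f : ℝ → ℝ} (hf : ContinuousOn f (Set.Ioi 0)) (hpos : spectrum ℝ A ⊆ Set.Ioi 0) :
    Tendsto (fun t : ℝ => cfc f (A + t • Δ)) (𝓝 0) (𝓝 (cfc f A)) := by
  set T : Set (Matrix m m ℂ) := {B | Set.Ioi (0 : ℝ) ∈ 𝓝ˢ (spectrum ℝ B)} with hT
  have hTo : IsOpen T := (upperHemicontinuous_spectrum ℝ (Matrix m m ℂ)).isOpen (Set.Ioi 0)
  have hTmem : ∀ B, B ∈ T ↔ spectrum ℝ B ⊆ Set.Ioi 0 := fun B => isOpen_Ioi.mem_nhdsSet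
  have hc : Continuous (fun t : ℝ => A + t • Δ) := by fun_prop
  have h0 : A + (0 : ℝ) • Δ = A := by simp
  have hmem : {t : ℝ | A + t • Δ ∈ T} ∈ 𝓝 (0 : ℝ) := by
    refine (hTo.preimage hc).mem_nhds ?_
    simp only [Set.mem_preimage, h0, hTmem, hpos]
  have := ContinuousOn.cfc_of_mem_nhdsSet (A := Matrix m m ℂ) (p := IsSelfAdjoint)
    (s := Set.Ioi 0) f (a := fun t : ℝ => A + t • Δ) (t := {t | A + t • Δ ∈ T})
    (by
      rw [isOpen_Ioi.mem_nhdsSet]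
      exact Set.iUnion₂_subset fun t ht => (hTmem _).1 ht) hc.continuousOn
    (fun t _ => hA.isSelfAdjoint.add ((IsSelfAdjoint.all t).smul hΔ.isSelfAdjoint)) hf
  have := (this.continuousAt hmem).tendsto
  simpa [h0] using this

lemma continuousOn_dslope_log {b : ℝ} (hb : 0 < b) :
    ContinuousOn (dslope Real.log b) (Set.Ioi 0) := by
  rw [continuousOn_dslope (Ioi_mem_nhds hb)]
  exact ⟨fun x hx => (Real.continuousAt_log (ne_of_gt hx)).continuousWithinAt,
    Real.differentiableAt_log hb.ne'⟩

lemma spectrum_spectralMatrix_subset {U : Matrix m m ℂ} (hU : U ∈ Matrix.unitaryGroup m ℂ)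
    {a : m → ℝ} (ha : ∀ i, 0 < a i) : spectrum ℝ (spectralMatrix U a) ⊆ Set.Ioi 0 := by
  intro x hx
  have h : spectralMatrix U a = Unitary.conjStarAlgAut ℂ _ (⟨U, hU⟩ : unitary (Matrix m m ℂ))
      (Matrix.diagonal fun i => (a i : ℂ)) := by
    rw [Unitary.conjStarAlgAut_apply]; rfl
  have hx' : (x : ℂ) ∈ spectrum ℂ (spectralMatrix U a) :=
    spectrum.algebraMap_mem ℂ hx
  rw [h, Unitary.conjStarAlgAut_apply, Unitary.spectrum_star_right_conjugate,
    spectrum_diagonal] at hx'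
  obtain ⟨i, hi⟩ := hx'
  have : a i = x := Complex.ofReal_injective hi
  exact this ▸ ha i

/-- The Daleckii–Krein formula under the trace: the difference quotient is given exactly by
`cfc_add_sub_cfc`, and its limit by `tendsto_cfc_add_smul`. -/
theorem hasDerivAt_trace_mul_cfc_log {U : Matrix m m ℂ} (hU : U ∈ Matrix.unitaryGroup m ℂ)
    {a : m → ℝ} (ha : ∀ i, 0 < a i) {Δ : Matrix m m ℂ} (hΔ : Δ.IsHermitian)
    (ρ : Matrix m m ℂ) :
    HasDerivAt (fun t : ℝ => (ρ * cfc Real.log (spectralMatrix U a + t • Δ)).trace.re)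
      (∑ j, ∑ k, dslope Real.log (a j) (a k) *
        ((Uᴴ * ρ * U) k j * (Uᴴ * Δ * U) j k).re) 0 := by
  rw [hasDerivAt_iff_tendsto_slope]
  have hA := isHermitian_spectralMatrix U a
  have hlim : Tendsto (fun t : ℝ => (ρ * ∑ j, colProj U j * Δ *
      cfc (dslope Real.log (a j)) (spectralMatrix U a + t • Δ)).trace.re) (𝓝 0)
      (𝓝 (ρ * ∑ j, colProj U j * Δ *
      cfc (dslope Real.log (a j)) (spectralMatrix U a)).trace.re) := by
    have hc : Continuous fun M : Matrix m m ℂ => (ρ * M).trace.re :=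
      Complex.continuous_re.comp
        (Continuous.matrix_trace (continuous_const.matrix_mul continuous_id))
    refine (hc.tendsto _).comp ?_
    refine tendsto_finsetSum _ fun j _ => ?_
    have hm : Continuous fun M : Matrix m m ℂ => colProj U j * Δ * M :=
      continuous_const.matrix_mul continuous_id
    exact (hm.tendsto _).comp (tendsto_cfc_add_smul hA hΔ (continuousOn_dslope_log (ha j))
      (spectrum_spectralMatrix_subset hU ha))
  have hval : (ρ * ∑ j, colProj U j * Δ *
      cfc (dslope Real.log (a j)) (spectralMatrix U a)).trace.re =
      ∑ j, ∑ k, dslope Real.log (a j) (a k) *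
        ((Uᴴ * ρ * U) k j * (Uᴴ * Δ * U) j k).re := by
    rw [Finset.mul_sum, Matrix.trace_sum, Complex.re_sum]
    refine Finset.sum_congr rfl fun j _ => ?_
    rw [cfc_spectralMatrix hU, trace_mul_colProj_mul, Complex.re_sum]
    refine Finset.sum_congr rfl fun k _ => ?_
    rw [Complex.re_mul_ofReal, mul_comm]
  rw [← hval]
  refine (hlim.mono_left nhdsWithin_le_nhds).congr' ?_
  filter_upwards [self_mem_nhdsWithin] with t ht
  have ht : t ≠ 0 := ht
  have h := cfc_add_sub_cfc hU a Real.log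
    ((IsSelfAdjoint.all t).smul hΔ.isSelfAdjoint : (t • Δ).IsHermitian)
  rw [slope_def_field]
  simp only [zero_smul, add_zero, sub_zero]
  rw [← Complex.sub_re, ← Matrix.trace_sub, ← mul_sub, h, eq_div_iff ht]
  simp only [mul_smul_comm, smul_mul_assoc, ← Finset.smul_sum, Matrix.trace_smul]
  simp [mul_comm]

end Spectral

/-! ### Inequalities for `t / sinh t` and divided differences of the logarithm. -/

section Hyperbolic

open Real

lemma strictMonoOn_Ici_of_hasDerivAt {f f' : ℝ → ℝ} (h : ∀ t, HasDerivAt f (f' t) t)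
    (hpos : ∀ t, 0 < t → 0 < f' t) : StrictMonoOn f (Set.Ici 0) := by
  refine strictMonoOn_of_deriv_pos (convex_Ici 0)
    (fun t _ => (h t).continuousAt.continuousWithinAt) fun t ht => ?_
  rw [(h t).deriv]
  exact hpos t (by simpa using ht)

lemma pos_of_hasDerivAt_pos {f f' : ℝ → ℝ} (h : ∀ t, HasDerivAt f (f' t) t) (h0 : f 0 = 0)
    (hpos : ∀ t, 0 < t → 0 < f' t) {t : ℝ} (ht : 0 < t) : 0 < f t := by
  have := strictMonoOn_Ici_of_hasDerivAt h hpos (Set.self_mem_Ici) ht.le ht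
  rwa [h0] at this

/-- The difference of the sides and its first derivative vanish at zero; the second derivative is
positive because `t < sinh t` and `1 ≤ cosh t`. -/
lemma two_mul_sq_mul_cosh_lt {t : ℝ} (ht : 0 < t) :
    2 * t ^ 2 * cosh t < sinh t ^ 2 * cosh t + t * sinh t := by
  have h2 : ∀ t : ℝ, 0 < t → 0 < 9 * sinh t ^ 2 * cosh t - 7 * t * sinh t
      - 2 * t ^ 2 * cosh t := by
    intro t ht
    have hs : t < sinh t := self_lt_sinh_iff.2 ht
    have hc : 1 ≤ cosh t := one_le_cosh t
    have h1 : t * sinh t < sinh t ^ 2 := by nlinarith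
    have h2 : t ^ 2 < sinh t ^ 2 := by nlinarith
    have h3 : sinh t ^ 2 ≤ sinh t ^ 2 * cosh t := by nlinarith [sq_nonneg (sinh t)]
    have h4 : t ^ 2 * cosh t < sinh t ^ 2 * cosh t := by nlinarith
    nlinarith
  have hd1 : ∀ t : ℝ, HasDerivAt
      (fun t => 3 * sinh t ^ 3 + 3 * sinh t - 3 * t * cosh t - 2 * t ^ 2 * sinh t)
      (9 * sinh t ^ 2 * cosh t - 7 * t * sinh t - 2 * t ^ 2 * cosh t) t := by
    intro t
    have := (((((hasDerivAt_sinh t).pow 3).const_mul 3).add ((hasDerivAt_sinh t).const_mul 3)).sub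
      (((hasDerivAt_id t).const_mul 3).mul (hasDerivAt_cosh t))).sub
      ((((hasDerivAt_id t).pow 2).const_mul 2).mul (hasDerivAt_sinh t))
    convert! this using 1
    simp
    ring
  have h1 : ∀ t : ℝ, 0 < t →
      0 < 3 * sinh t ^ 3 + 3 * sinh t - 3 * t * cosh t - 2 * t ^ 2 * sinh t :=
    fun t ht => pos_of_hasDerivAt_pos hd1 (by simp) h2 ht
  have hd0 : ∀ t : ℝ, HasDerivAt
      (fun t => sinh t ^ 2 * cosh t + t * sinh t - 2 * t ^ 2 * cosh t)
      (3 * sinh t ^ 3 + 3 * sinh t - 3 * t * cosh t - 2 * t ^ 2 * sinh t) t := by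
    intro t
    have := ((((hasDerivAt_sinh t).pow 2).mul (hasDerivAt_cosh t)).add
      ((hasDerivAt_id t).mul (hasDerivAt_sinh t))).sub
      ((((hasDerivAt_id t).pow 2).const_mul 2).mul (hasDerivAt_cosh t))
    convert! this using 1
    simp
    linear_combination (-2 * sinh t) * (cosh_sq t)
  linarith [pos_of_hasDerivAt_pos hd0 (by simp) h1 ht]

lemma self_lt_sinh_mul_cosh {t : ℝ} (ht : 0 < t) : t < sinh t * cosh t := by
  have hs : t < sinh t := self_lt_sinh_iff.2 ht
  nlinarith [one_le_cosh t]

/-- The even function `t / sinh t`, with its limit `1` at `0`. -/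
noncomputable def divSinh (t : ℝ) : ℝ := if t = 0 then 1 else t / sinh t

lemma divSinh_zero : divSinh 0 = 1 := by simp [divSinh]

lemma divSinh_of_ne {t : ℝ} (ht : t ≠ 0) : divSinh t = t / sinh t := by simp [divSinh, ht]

lemma divSinh_neg (t : ℝ) : divSinh (-t) = divSinh t := by
  by_cases ht : t = 0
  · simp [ht]
  · rw [divSinh_of_ne ht, divSinh_of_ne (neg_ne_zero.2 ht), sinh_neg, neg_div_neg_eq]

lemma divSinh_abs (t : ℝ) : divSinh |t| = divSinh t := by
  rcases abs_choice t with h | h <;> rw [h]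
  exact divSinh_neg t

lemma strictMonoOn_mul_coth : StrictMonoOn (fun t => t * cosh t / sinh t) (Set.Ioi 0) := by
  have hd : ∀ t : ℝ, 0 < t → HasDerivAt (fun t => t * cosh t / sinh t)
      ((sinh t * cosh t - t) / sinh t ^ 2) t := by
    intro t ht
    have := (((hasDerivAt_id t).mul (hasDerivAt_cosh t)).div (hasDerivAt_sinh t)
      (sinh_pos_iff.2 ht).ne')
    convert! this using 1
    simp
    congr 1
    linear_combination t * (cosh_sq t)
  refine strictMonoOn_of_deriv_pos (convex_Ioi 0)
    (fun t ht => (hd t ht).continuousAt.continuousWithinAt) fun t ht => ?_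
  have ht : 0 < t := by simpa using ht
  rw [(hd t ht).deriv]
  have := sinh_pos_iff.2 ht
  have := self_lt_sinh_mul_cosh ht
  apply div_pos <;> [linarith; positivity]

/-- Clearing denominators in `two_mul_divSinh_mul_divSinh_lt_of_lt` compares exactly this function
at `u` and `v`. The sign of its derivative is `two_mul_sq_mul_cosh_lt`. -/
lemma strictAntiOn_sinh_mul_cosh_sub_div :
    StrictAntiOn (fun t => (sinh t * cosh t - t) / (t * sinh t ^ 2)) (Set.Ioi 0) := by
  have hd : ∀ t : ℝ, 0 < t → HasDerivAt (fun t => (sinh t * cosh t - t) / (t * sinh t ^ 2))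
      (-(sinh t * (sinh t ^ 2 * cosh t + t * sinh t - 2 * t ^ 2 * cosh t)) /
        (t * sinh t ^ 2) ^ 2) t := by
    intro t ht
    have hs := sinh_pos_iff.2 ht
    have := (((hasDerivAt_sinh t).mul (hasDerivAt_cosh t)).sub (hasDerivAt_id t)).div
      ((hasDerivAt_id t).mul ((hasDerivAt_sinh t).pow 2))
      (by simp only [Pi.mul_apply, Pi.pow_apply, id]; positivity)
    convert! this using 1
    simp
    congr 1
    linear_combination (t * sinh t ^ 2) * (cosh_sq t)
  refine strictAntiOn_of_deriv_neg (convex_Ioi 0)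
    (fun t ht => (hd t ht).continuousAt.continuousWithinAt) fun t ht => ?_
  have ht : 0 < t := by simpa using ht
  rw [(hd t ht).deriv]
  have hs := sinh_pos_iff.2 ht
  have := two_mul_sq_mul_cosh_lt ht
  refine div_neg_of_neg_of_pos (neg_neg_of_pos (mul_pos hs (by linarith))) (by positivity)

/-- By the addition formulas for `sinh`, this amounts to `v * coth v < u * coth u`. -/
lemma divSinh_add_lt_divSinh_sub {u v : ℝ} (hv : 0 < v) (hvu : v < u) :
    divSinh (u + v) < divSinh (u - v) := by
  have hu : 0 < u := hv.trans hvu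
  rw [divSinh_of_ne (by linarith), divSinh_of_ne (by linarith)]
  have h1 : 0 < sinh (u + v) := sinh_pos_iff.2 (by linarith)
  have h2 : 0 < sinh (u - v) := sinh_pos_iff.2 (by linarith)
  have h3 := sinh_pos_iff.2 hu
  have h4 := sinh_pos_iff.2 hv
  have h := strictMonoOn_mul_coth hv hu hvu
  simp only [] at h
  rw [div_lt_div_iff₀ h4 h3] at h
  rw [div_lt_div_iff₀ h1 h2, sinh_add, sinh_sub]
  nlinarith

lemma two_mul_divSinh_mul_divSinh_lt_of_lt {u v : ℝ} (hv : 0 < v) (hvu : v < u) :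
    2 * (divSinh u * divSinh v) < divSinh (u + v) + divSinh (u - v) := by
  have hu : 0 < u := hv.trans hvu
  rw [divSinh_of_ne (t := u + v) (by linarith), divSinh_of_ne (t := u - v) (by linarith),
    divSinh_of_ne hu.ne', divSinh_of_ne hv.ne']
  have h1 : 0 < sinh (u + v) := sinh_pos_iff.2 (by linarith)
  have h2 : 0 < sinh (u - v) := sinh_pos_iff.2 (by linarith)
  have h3 := sinh_pos_iff.2 hu
  have h4 := sinh_pos_iff.2 hv
  have h := strictAntiOn_sinh_mul_cosh_sub_div hv hu hvu
  simp only [] at h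
  rw [div_lt_div_iff₀ (by positivity) (by positivity)] at h
  have e : 2 * (u / sinh u * (v / sinh v)) = (2 * u * v) / (sinh u * sinh v) := by
    field_simp
  rw [e, div_add_div _ _ h1.ne' h2.ne', div_lt_div_iff₀ (by positivity) (by positivity),
    sinh_add, sinh_sub]
  have hcu := cosh_sq u
  have hcv := cosh_sq v
  have e1 : 2 * u * v * ((sinh u * cosh v + cosh u * sinh v) *
      (sinh u * cosh v - cosh u * sinh v)) = 2 * u * v * (sinh u ^ 2 - sinh v ^ 2) := by
    linear_combination (2 * u * v * sinh u ^ 2) * hcv - (2 * u * v * sinh v ^ 2) * hcu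
  rw [e1]
  linarith

lemma divSinh_two_mul_lt {u : ℝ} (hu : 0 < u) : divSinh (u + u) < 1 := by
  rw [divSinh_of_ne (by linarith), div_lt_one (sinh_pos_iff.2 (by linarith))]
  exact self_lt_sinh_iff.2 (by linarith)

lemma two_mul_divSinh_sq_lt {u : ℝ} (hu : 0 < u) :
    2 * (divSinh u * divSinh u) < divSinh (u + u) + 1 := by
  have h3 := sinh_pos_iff.2 hu
  have hc := cosh_pos u
  rw [divSinh_of_ne (t := u + u) (by linarith), divSinh_of_ne hu.ne', sinh_add]
  have h := two_mul_sq_mul_cosh_lt hu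
  have e : (u + u) / (sinh u * cosh u + cosh u * sinh u) + 1 - 2 * (u / sinh u * (u / sinh u)) =
      (sinh u ^ 2 * cosh u + u * sinh u - 2 * u ^ 2 * cosh u) / (sinh u ^ 2 * cosh u) := by
    have : sinh u * cosh u + cosh u * sinh u = 2 * (sinh u * cosh u) := by ring
    rw [this]
    field_simp
    ring
  have : 0 < (sinh u ^ 2 * cosh u + u * sinh u - 2 * u ^ 2 * cosh u) / (sinh u ^ 2 * cosh u) :=
    div_pos (by linarith) (by positivity)
  linarith

/-- Both relations are symmetric in `u` and `v` since `divSinh` is even. The diagonal `u = v` is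
separate because there `u - v` hits the removable singularity. -/
lemma divSinh_sub_ne_add_of_pos {u v : ℝ} (hu : 0 < u) (hv : 0 < v) :
    divSinh (u - v) ≠ divSinh (u + v) ∧
      divSinh (u + v) + divSinh (u - v) ≠ 2 * (divSinh u * divSinh v) := by
  rcases lt_trichotomy v u with h | h | h
  · exact ⟨(divSinh_add_lt_divSinh_sub hv h).ne',
      (two_mul_divSinh_mul_divSinh_lt_of_lt hv h).ne'⟩
  · subst h
    rw [sub_self, divSinh_zero]
    exact ⟨(divSinh_two_mul_lt hu).ne', (two_mul_divSinh_sq_lt hu).ne'⟩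
  · rw [← neg_sub v u, divSinh_neg, add_comm u v, mul_comm (divSinh u)]
    exact ⟨(divSinh_add_lt_divSinh_sub hu h).ne',
      (two_mul_divSinh_mul_divSinh_lt_of_lt hu h).ne'⟩

lemma divSinh_sub_ne_add {u v : ℝ} (hu : u ≠ 0) (hv : v ≠ 0) :
    divSinh (u - v) ≠ divSinh (u + v) ∧
      divSinh (u + v) + divSinh (u - v) ≠ 2 * (divSinh u * divSinh v) := by
  have h := divSinh_sub_ne_add_of_pos (abs_pos.2 hu) (abs_pos.2 hv)
  rw [divSinh_abs, divSinh_abs] at h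
  rcases abs_choice u with h1 | h1 <;> rcases abs_choice v with h2 | h2 <;> rw [h1, h2] at h
  · exact h
  · rw [sub_neg_eq_add, ← sub_eq_add_neg, add_comm (divSinh (u - v))] at h
    exact ⟨h.1.symm, h.2⟩
  · rw [← neg_add', neg_add_eq_sub, ← neg_sub u v, divSinh_neg, divSinh_neg,
      add_comm (divSinh (u - v))] at h
    exact ⟨h.1.symm, h.2⟩
  · rw [neg_sub_neg, ← neg_sub u v, ← neg_add, divSinh_neg, divSinh_neg] at h
    exact h

/-- The quotient of `2 * u` by `2 * exp c * sinh u`. With eigenvalues written as `exp (c ± u)`,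
multiplying them adds the parameters, which turns questions about products into questions about
`divSinh`. -/
lemma dslope_log_exp (c u : ℝ) :
    dslope log (exp (c + u)) (exp (c - u)) = divSinh u / exp c := by
  by_cases hu : u = 0
  · subst hu
    rw [add_zero, sub_zero, dslope_same, divSinh_zero, Real.deriv_log, one_div]
  · have hne : exp (c - u) ≠ exp (c + u) := fun h => hu (by
      have := exp_injective h
      linarith)
    rw [dslope_of_ne _ hne, slope_def_field, divSinh_of_ne hu, log_exp, log_exp, sinh_eq]
    have h1 : exp (c - u) - exp (c + u) = - (exp c * (exp u - exp (-u))) := by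
      rw [sub_eq_add_neg c u, exp_add, exp_add]; ring
    have h2 : exp u - exp (-u) ≠ 0 := fun h => hu (by
      have := exp_injective (sub_eq_zero.1 h)
      linarith)
    rw [h1]
    field_simp
    ring

lemma exists_exp_add_sub {x y : ℝ} (hx : 0 < x) (hy : 0 < y) :
    ∃ c u : ℝ, x = exp (c + u) ∧ y = exp (c - u) :=
  ⟨(log x + log y) / 2, (log x - log y) / 2, by
    rw [show (log x + log y) / 2 + (log x - log y) / 2 = log x by ring, exp_log hx], by
    rw [show (log x + log y) / 2 - (log x - log y) / 2 = log y by ring, exp_log hy]⟩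

/-- The divided differences of the logarithm at products: they differ at `(x₀y₀, x₁y₁)` and
`(x₀y₁, x₁y₀)`, and their mean is not the product of those at `(x₀, x₁)` and `(y₀, y₁)`. -/
lemma dslope_log_mul_ne {x₀ x₁ y₀ y₁ : ℝ} (hx₀ : 0 < x₀) (hx₁ : 0 < x₁) (hy₀ : 0 < y₀)
    (hy₁ : 0 < y₁) (hx : x₀ ≠ x₁) (hy : y₀ ≠ y₁) :
    dslope log (x₀ * y₁) (x₁ * y₀) ≠ dslope log (x₀ * y₀) (x₁ * y₁) ∧
      dslope log (x₀ * y₀) (x₁ * y₁) + dslope log (x₀ * y₁) (x₁ * y₀) ≠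
        2 * (dslope log x₀ x₁ * dslope log y₀ y₁) := by
  obtain ⟨c, u, rfl, rfl⟩ := exists_exp_add_sub hx₀ hx₁
  obtain ⟨d, v, rfl, rfl⟩ := exists_exp_add_sub hy₀ hy₁
  have hu : u ≠ 0 := fun h => hx (by simp [h])
  have hv : v ≠ 0 := fun h => hy (by simp [h])
  simp only [← exp_add]
  -- Both pairs of products have the same mean exponent `c + d`; their half-differences are `u - v`
  -- and `u + v`.
  rw [show c + u + (d - v) = (c + d) + (u - v) by ring,
    show c - u + (d + v) = (c + d) - (u - v) by ring,
    show c + u + (d + v) = (c + d) + (u + v) by ring,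
    show c - u + (d - v) = (c + d) - (u + v) by ring]
  simp only [dslope_log_exp]
  obtain ⟨h1, h2⟩ := divSinh_sub_ne_add hu hv
  have hpos := exp_ne_zero (c + d)
  refine ⟨fun h => h1 ?_, fun h => h2 ?_⟩
  · exact (div_left_inj' hpos).1 h
  · rw [← add_div, div_mul_div_comm, ← exp_add, ← mul_div_assoc] at h
    exact (div_left_inj' hpos).1 h

/-- Homogeneity of degree -1. It lets common eigenvalue factors of the unperturbed sites cancel. -/
lemma dslope_log_mul_left {a x y : ℝ} (ha : 0 < a) (hx : 0 < x) (hy : 0 < y) :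
    dslope log (a * x) (a * y) = dslope log x y / a := by
  obtain ⟨c, u, rfl, rfl⟩ := exists_exp_add_sub hx hy
  obtain ⟨d, rfl⟩ : ∃ d, a = exp d := ⟨log a, (exp_log ha).symm⟩
  rw [← exp_add, ← exp_add, ← add_assoc, ← add_sub_assoc, dslope_log_exp, dslope_log_exp, exp_add,
    div_div, mul_comm]

lemma dslope_log_self {x : ℝ} : dslope log x x = 1 / x := by
  rw [dslope_same, Real.deriv_log, one_div]

lemma dslope_comm (f : ℝ → ℝ) (x y : ℝ) : dslope f x y = dslope f y x := by
  by_cases h : x = y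
  · rw [h]
  · rw [dslope_of_ne _ h, dslope_of_ne _ (Ne.symm h), slope_comm]

end Hyperbolic

/-! ### Algebra of tensor products and sums over product index sets. -/

section Tensor

lemma sum_bits {M : Type*} [AddCommMonoid M] (f : (Fin 1 → Fin 2) → M) :
    ∑ j, f j = ∑ x : Fin 2, f (fun _ => x) :=
  ((Equiv.funUnique (Fin 1) (Fin 2)).symm.sum_comp f).symm

lemma bits_eq (j : Fin 1 → Fin 2) : j = fun _ => j 0 := by
  ext i; rw [Subsingleton.elim i 0]

variable {n : ℕ}

lemma tensorProd_apply (A : Fin n → Op 1) (j k : Fin n → Fin 2) :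
    tensorProd A j k = ∏ i, A i (fun _ => j i) (fun _ => k i) := rfl

lemma tensorProd_mul (A B : Fin n → Op 1) :
    tensorProd A * tensorProd B = tensorProd fun i => A i * B i := by
  ext j k
  simp only [Matrix.mul_apply, tensorProd_apply, ← Finset.prod_mul_distrib, sum_bits]
  rw [Fintype.prod_sum]

lemma conjTranspose_tensorProd (A : Fin n → Op 1) :
    (tensorProd A)ᴴ = tensorProd fun i => (A i)ᴴ := by
  ext j k
  simp [Matrix.conjTranspose_apply, tensorProd_apply]

lemma tensorProd_diagonal (d : Fin n → (Fin 1 → Fin 2) → ℂ) :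
    tensorProd (fun i => Matrix.diagonal (d i)) =
      Matrix.diagonal fun j => ∏ i, d i (fun _ => j i) := by
  ext j k
  rw [tensorProd_apply, Matrix.diagonal_apply]
  split_ifs with h
  · simp [h]
  · obtain ⟨i, hi⟩ := Function.ne_iff.1 h
    refine Finset.prod_eq_zero (Finset.mem_univ i) (Matrix.diagonal_apply_ne _ ?_)
    exact fun h' => hi (congrFun h' 0)

lemma tensorProd_one : tensorProd (fun _ : Fin n => (1 : Op 1)) = 1 := by
  simp only [← Matrix.diagonal_one, tensorProd_diagonal, Finset.prod_const_one]

lemma tensorProd_smul (c : Fin n → ℂ) (A : Fin n → Op 1) :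
    tensorProd (fun i => c i • A i) = (∏ i, c i) • tensorProd A := by
  ext j k
  simp [tensorProd_apply, Finset.prod_mul_distrib]

lemma tensorProd_mem_unitaryGroup {U : Fin n → Op 1}
    (hU : ∀ i, U i ∈ Matrix.unitaryGroup (Fin 1 → Fin 2) ℂ) :
    tensorProd U ∈ Matrix.unitaryGroup (Fin n → Fin 2) ℂ := by
  rw [Matrix.mem_unitaryGroup_iff, Matrix.star_eq_conjTranspose, conjTranspose_tensorProd,
    tensorProd_mul]
  simp only [mul_conjTranspose_self_of_mem (hU _), tensorProd_one]

lemma tensorProd_spectralMatrix (U : Fin n → Op 1) (a : Fin n → (Fin 1 → Fin 2) → ℝ) :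
    tensorProd (fun i => spectralMatrix (U i) (a i)) =
      spectralMatrix (tensorProd U) fun j => ∏ i, a i (fun _ => j i) := by
  simp only [spectralMatrix, conjTranspose_tensorProd]
  push_cast
  rw [← tensorProd_mul, ← tensorProd_mul, tensorProd_diagonal]

lemma conj_tensorProd (U A : Fin n → Op 1) :
    (tensorProd U)ᴴ * tensorProd A * tensorProd U =
      tensorProd fun i => (U i)ᴴ * A i * U i := by
  rw [conjTranspose_tensorProd, tensorProd_mul, tensorProd_mul]

lemma isHermitian_tensorProd {A : Fin n → Op 1} (hA : ∀ i, (A i).IsHermitian) :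
    (tensorProd A).IsHermitian := by
  rw [Matrix.IsHermitian, conjTranspose_tensorProd]
  simp only [fun i => (hA i).eq]

lemma tensorProd_update_apply (A : Fin n → Op 1) (a : Fin n) (X : Op 1) (j k : Fin n → Fin 2) :
    tensorProd (Function.update A a X) j k = X (fun _ => j a) (fun _ => k a) *
      ∏ i ∈ Finset.univ.erase a, A i (fun _ => j i) (fun _ => k i) := by
  rw [tensorProd_apply, ← Finset.mul_prod_erase _ _ (Finset.mem_univ a)]
  congr 1
  · simp
  · refine Finset.prod_congr rfl fun i hi => ?_
    rw [Function.update_of_ne (Finset.ne_of_mem_erase hi)]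

/-- The tensor product as a linear function of its factor at `a`. -/
def tensorProdUpdate (A : Fin n → Op 1) (a : Fin n) : Op 1 →ₗ[ℝ] Op n where
  toFun X := tensorProd (Function.update A a X)
  map_add' X Y := by
    ext j k
    simp only [Matrix.add_apply, tensorProd_update_apply, add_mul]
  map_smul' r X := by
    ext j k
    simp only [Matrix.smul_apply, tensorProd_update_apply, RingHom.id_apply, smul_mul_assoc]

lemma tensorProdUpdate_apply (A : Fin n → Op 1) (a : Fin n) (X : Op 1) :
    tensorProdUpdate A a X = tensorProd (Function.update A a X) := rfl

/-- A sum over functions of a product of weights, with one factor that depends on the value at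
`a`, where all other weights sum to one. -/
lemma sum_mul_prod_of_sum_eq_one {α R : Type*} [Fintype α] [CommRing R]
    (M : Fin n → α → R) (a : Fin n) (hM : ∀ i, i ≠ a → ∑ x, M i x = 1) (G : α → R) :
    ∑ f : Fin n → α, G (f a) * ∏ i, M i (f i) = ∑ x, G x * M a x := by
  have h : ∀ f : Fin n → α, G (f a) * ∏ i, M i (f i) =
      ∏ i, Function.update M a (fun x => G x * M a x) i (f i) := by
    intro f
    rw [← Finset.mul_prod_erase _ _ (Finset.mem_univ a),
      ← Finset.mul_prod_erase Finset.univ (fun i => Function.update M a _ i (f i))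
        (Finset.mem_univ a), Function.update_self, mul_assoc]
    congr 2
    refine Finset.prod_congr rfl fun i hi => ?_
    rw [Function.update_of_ne (Finset.ne_of_mem_erase hi)]
  simp only [h]
  rw [← Fintype.prod_sum, ← Finset.mul_prod_erase _ _ (Finset.mem_univ a), Function.update_self,
    Finset.prod_eq_one, mul_one]
  intro i hi
  rw [Function.update_of_ne (Finset.ne_of_mem_erase hi), hM i (Finset.ne_of_mem_erase hi)]

/-- A sum over functions of a product of weights, with one factor that depends on the values at
`a` and `b`, where all other weights sum to one. -/
lemma sum_mul_prod_of_sum_eq_one₂ {α R : Type*} [Fintype α] [CommRing R]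
    (M : Fin n → α → R) {a b : Fin n} (hab : a ≠ b)
    (hM : ∀ i, i ≠ a → i ≠ b → ∑ x, M i x = 1) (G : α → α → R) :
    ∑ f : Fin n → α, G (f a) (f b) * ∏ i, M i (f i) = ∑ x, ∑ y, G x y * (M a x * M b y) := by
  classical
  -- The weights `W x y` force the values `x` at `a` and `y` at `b`, so the sum over functions
  -- factors over the sites.
  let W (x y : α) (i : Fin n) (z : α) : R :=
    if (i = a → z = x) ∧ (i = b → z = y) then M i z else 0
  have hW : ∀ x y (f : Fin n → α), ∏ i, W x y i (f i) =
      if f a = x then if f b = y then ∏ i, M i (f i) else 0 else 0 := by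
    intro x y f
    split_ifs with hx hy
    · refine Finset.prod_congr rfl fun i _ => if_pos ⟨?_, ?_⟩
      · rintro rfl; exact hx
      · rintro rfl; exact hy
    · exact Finset.prod_eq_zero (Finset.mem_univ b) (if_neg fun h => hy (h.2 rfl))
    · exact Finset.prod_eq_zero (Finset.mem_univ a) (if_neg fun h => hx (h.1 rfl))
  have hsum : ∀ x y, ∑ f : Fin n → α, ∏ i, W x y i (f i) = M a x * M b y := by
    intro x y
    rw [← Fintype.prod_sum, ← Finset.mul_prod_erase _ _ (Finset.mem_univ a),
      ← Finset.mul_prod_erase _ _ (Finset.mem_erase.2 ⟨hab.symm, Finset.mem_univ b⟩),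
      Finset.prod_eq_one, mul_one]
    · simp [W, hab, hab.symm]
    · intro i hi
      simp only [Finset.mem_erase, Finset.mem_univ, and_true] at hi
      simpa [W, hi.1, hi.2] using hM i hi.2 hi.1
  simp only [← hsum, Finset.mul_sum]
  rw [Finset.sum_congr rfl fun x _ => Finset.sum_comm, Finset.sum_comm]
  refine Finset.sum_congr rfl fun f _ => ?_
  simp [hW]

end Tensor

/-! ### The stabilizer octahedron and products of stabilizer states. -/

section Clifford

/-- A `2 × 2` matrix as a single-qubit operator. -/
def ofMatrix (A : Matrix (Fin 2) (Fin 2) ℂ) : Op 1 := A.submatrix (fun j => j 0) (fun j => j 0)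

lemma ofMatrix_mul (A B : Matrix (Fin 2) (Fin 2) ℂ) :
    ofMatrix A * ofMatrix B = ofMatrix (A * B) := by
  ext j k
  simp only [ofMatrix, Matrix.mul_apply, Matrix.submatrix_apply, sum_bits]

lemma ofMatrix_one : ofMatrix 1 = 1 := by
  ext j k
  rw [bits_eq j, bits_eq k]
  simp [ofMatrix, Matrix.one_apply, funext_iff]

lemma conjTranspose_ofMatrix (A : Matrix (Fin 2) (Fin 2) ℂ) : (ofMatrix A)ᴴ = ofMatrix Aᴴ := rfl

lemma smul_ofMatrix (c : ℂ) (A : Matrix (Fin 2) (Fin 2) ℂ) :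
    c • ofMatrix A = ofMatrix (c • A) := rfl

lemma pauli_eq (a : Fin 4) : pauli a = ofMatrix (pauliMatrix a) := rfl

lemma trace_ofMatrix (A : Matrix (Fin 2) (Fin 2) ℂ) : (ofMatrix A).trace = A.trace := by
  simp only [Matrix.trace, sum_bits]
  rfl

lemma pauliMatrix_mul_self (a : Fin 4) : pauliMatrix a * pauliMatrix a = 1 := by
  fin_cases a <;> ext i j <;> fin_cases i <;> fin_cases j <;>
    simp [pauliMatrix, Matrix.mul_apply]

lemma isHermitian_pauliMatrix (a : Fin 4) : (pauliMatrix a)ᴴ = pauliMatrix a := by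
  fin_cases a <;> ext i j <;> fin_cases i <;> fin_cases j <;> simp [pauliMatrix]

lemma trace_pauliMatrix {a : Fin 4} (ha : a ≠ 0) : (pauliMatrix a).trace = 0 := by
  fin_cases a <;> simp [pauliMatrix, Matrix.trace] at ha ⊢

lemma pauli_zero : pauli 0 = 1 := by
  rw [pauli_eq, ← ofMatrix_one]
  congr 1
  ext i j
  fin_cases i <;> fin_cases j <;> simp [pauliMatrix]

lemma pauli_mul_self (a : Fin 4) : pauli a * pauli a = 1 := by
  rw [pauli_eq, ofMatrix_mul, pauliMatrix_mul_self, ofMatrix_one]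

lemma isHermitian_pauli (a : Fin 4) : (pauli a).IsHermitian := by
  rw [Matrix.IsHermitian, pauli_eq, conjTranspose_ofMatrix, isHermitian_pauliMatrix]

lemma trace_pauli {a : Fin 4} (ha : a ≠ 0) : (pauli a).trace = 0 := by
  rw [pauli_eq, trace_ofMatrix, trace_pauliMatrix ha]

lemma pauli_mul_pauli_mul_pauli (a b : Fin 4) : ∃ k : ℕ,
    pauli a * pauli b * pauli a = Complex.I ^ k • pauli b := by
  have h : ∃ k : ℕ, pauliMatrix a * pauliMatrix b * pauliMatrix a =
      Complex.I ^ k • pauliMatrix b := by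
    have : pauliMatrix a * pauliMatrix b * pauliMatrix a = pauliMatrix b ∨
        pauliMatrix a * pauliMatrix b * pauliMatrix a = - pauliMatrix b := by
      fin_cases a <;> fin_cases b <;>
        first
        | (left; ext i j; fin_cases i <;> fin_cases j <;>
            simp [pauliMatrix, Matrix.mul_apply]; done)
        | (right; ext i j; fin_cases i <;> fin_cases j <;>
            simp [pauliMatrix, Matrix.mul_apply])
    rcases this with h | h
    · exact ⟨0, by rw [h, pow_zero, one_smul]⟩
    · exact ⟨2, by rw [h, Complex.I_sq, neg_one_smul]⟩
  obtain ⟨k, hk⟩ := h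
  exact ⟨k, by rw [pauli_eq, pauli_eq, ofMatrix_mul, ofMatrix_mul, hk, smul_ofMatrix]⟩

lemma tensorProd_one_qubit (A : Fin 1 → Op 1) : tensorProd A = A 0 := by
  ext j k
  rw [tensorProd_apply, Fin.prod_univ_one, ← bits_eq j, ← bits_eq k]

lemma pauli_mem_pauliGroup (a : Fin 4) : pauli a ∈ pauliGroup 1 :=
  ⟨0, fun _ => a, by rw [tensorProd_one_qubit, pow_zero, one_smul]⟩

lemma mem_pauliGroup_one {P : Op 1} :
    P ∈ pauliGroup 1 ↔ ∃ (k : ℕ) (a : Fin 4), P = Complex.I ^ k • pauli a := by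
  constructor
  · rintro ⟨k, a, rfl⟩
    exact ⟨k, a 0, by rw [tensorProd_one_qubit]⟩
  · rintro ⟨k, a, rfl⟩
    exact ⟨k, fun _ => a, by rw [tensorProd_one_qubit]⟩

lemma mem_cliffordGroup_one {U : Op 1} (hU : U * Uᴴ = 1)
    (h : ∀ a, ∃ (k : ℕ) (b : Fin 4), U * pauli a * Uᴴ = Complex.I ^ k • pauli b) :
    U ∈ cliffordGroup 1 := by
  refine ⟨Matrix.mem_unitaryGroup_iff.2 hU, fun P hP => ?_⟩
  obtain ⟨k, a, rfl⟩ := mem_pauliGroup_one.1 hP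
  obtain ⟨l, b, hb⟩ := h a
  rw [mul_smul_comm, smul_mul_assoc, hb, smul_smul, ← pow_add]
  exact mem_pauliGroup_one.2 ⟨_, _, rfl⟩

lemma pauli_mem_cliffordGroup (a : Fin 4) : pauli a ∈ cliffordGroup 1 := by
  refine mem_cliffordGroup_one ?_ fun b => ?_ <;> rw [(isHermitian_pauli a).eq]
  · exact pauli_mul_self a
  · obtain ⟨k, hk⟩ := pauli_mul_pauli_mul_pauli a b
    exact ⟨k, b, hk⟩

lemma mul_mem_cliffordGroup {n : ℕ} {U V : Op n} (hU : U ∈ cliffordGroup n)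
    (hV : V ∈ cliffordGroup n) : U * V ∈ cliffordGroup n := by
  refine ⟨mul_mem hU.1 hV.1, fun P hP => ?_⟩
  have := hU.2 _ (hV.2 P hP)
  rw [Matrix.conjTranspose_mul]
  simpa only [mul_assoc] using this

/-- The unitary `(I - i(X + Y + Z)) / 2`, which permutes the Pauli matrices cyclically. -/
noncomputable def cycleMatrix : Matrix (Fin 2) (Fin 2) ℂ :=
  !![⟨1 / 2, -1 / 2⟩, ⟨-1 / 2, -1 / 2⟩; ⟨1 / 2, -1 / 2⟩, ⟨1 / 2, 1 / 2⟩]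

lemma cycleMatrix_mul_conjTranspose : cycleMatrix * cycleMatrixᴴ = 1 := by
  ext i j
  fin_cases i <;> fin_cases j <;>
    simp [cycleMatrix, Matrix.mul_apply, Complex.ext_iff] <;> norm_num

lemma cycleMatrix_conj (a : Fin 4) :
    cycleMatrix * pauliMatrix a * cycleMatrixᴴ = pauliMatrix (![0, 2, 3, 1] a) := by
  fin_cases a <;> ext i j <;> fin_cases i <;> fin_cases j <;>
    simp [cycleMatrix, pauliMatrix, Matrix.mul_apply, Complex.ext_iff] <;> norm_num

lemma cycle_conj (a : Fin 4) :
    ofMatrix cycleMatrix * pauli a * (ofMatrix cycleMatrix)ᴴ = pauli (![0, 2, 3, 1] a) := by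
  rw [pauli_eq, conjTranspose_ofMatrix, ofMatrix_mul, ofMatrix_mul, cycleMatrix_conj, pauli_eq]

lemma cycle_mem_cliffordGroup : ofMatrix cycleMatrix ∈ cliffordGroup 1 := by
  refine mem_cliffordGroup_one ?_ fun a => ⟨0, ![0, 2, 3, 1] a, ?_⟩
  · rw [conjTranspose_ofMatrix, ofMatrix_mul, cycleMatrix_mul_conjTranspose, ofMatrix_one]
  · rw [cycle_conj, pow_zero, one_smul]

lemma zeroState_eq (n : ℕ) :
    zeroState n = Matrix.diagonal fun j => if j = 0 then 1 else 0 := by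
  ext j k
  simp only [zeroState, Matrix.single_apply, Matrix.diagonal_apply]
  by_cases hj : j = 0 <;> by_cases hk : j = k <;> simp_all [eq_comm]

lemma zeroState_one : zeroState 1 = (1 / 2 : ℝ) • (1 + pauli 3) := by
  ext j k
  rw [zeroState_eq, bits_eq j, bits_eq k, ← pauli_zero]
  simp only [Matrix.diagonal_apply, funext_iff, Pi.zero_apply, Fin.forall_fin_one]
  generalize j 0 = x
  generalize k 0 = y
  fin_cases x <;> fin_cases y <;> (simp [pauli, pauliMatrix]; try norm_num)

/-- The operator with Bloch vector `c`. -/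
noncomputable def bloch (c : Fin 3 → ℝ) : Op 1 :=
  (1 / 2 : ℝ) • (1 + ∑ p, c p • pauli p.succ)

lemma bloch_single (p : Fin 3) (s : ℝ) :
    bloch (Pi.single p s) = (1 / 2 : ℝ) • (1 + s • pauli p.succ) := by
  rw [bloch, Finset.sum_eq_single p]
  · simp
  · intro q _ hq; simp [hq]
  · simp

lemma bloch_combo {c d : Fin 3 → ℝ} {a b : ℝ} (hab : a + b = 1) :
    a • bloch c + b • bloch d = bloch (a • c + b • d) := by
  have h : (1 : Op 1) = a • 1 + b • 1 := by rw [← add_smul, hab, one_smul]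
  simp only [bloch, Pi.add_apply, Pi.smul_apply, smul_eq_mul]
  conv_rhs => rw [h]
  simp only [add_smul, Finset.sum_add_distrib, ← smul_smul, ← Finset.smul_sum]
  module

lemma bloch_add_smul (c d : Fin 3 → ℝ) (t : ℝ) :
    bloch (c + t • d) = bloch c + t • (bloch d - bloch 0) := by
  simp only [bloch, Pi.add_apply, Pi.smul_apply, Pi.zero_apply, smul_eq_mul, zero_smul,
    Finset.sum_const_zero, add_smul, Finset.sum_add_distrib, ← smul_smul, ← Finset.smul_sum]
  module

/-- Conjugation preserves the trace, which excludes the identity, and the square, which excludes the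
phases `±i`. -/
lemma exists_conj_eq_of_mem_cliffordGroup {U : Op 1} (hU : U ∈ cliffordGroup 1) {a : Fin 4}
    (ha : a ≠ 0) : ∃ (p : Fin 3) (s : ℝ), |s| = 1 ∧ U * pauli a * Uᴴ = s • pauli p.succ := by
  obtain ⟨k, b, h⟩ := mem_pauliGroup_one.1 (hU.2 _ (pauli_mem_pauliGroup a))
  have hUU := conjTranspose_mul_self_of_mem hU.1
  have hb : b ≠ 0 := by
    rintro rfl
    have ht := congrArg Matrix.trace h
    rw [Matrix.trace_mul_comm, ← mul_assoc, hUU, one_mul, trace_pauli ha, pauli_zero,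
      Matrix.trace_smul, Matrix.trace_one] at ht
    simp at ht
  have hsq : (Complex.I ^ k * Complex.I ^ k) • (1 : Op 1) = 1 := by
    have h2 : (U * pauli a * Uᴴ) * (U * pauli a * Uᴴ) = 1 := by
      calc _ = U * pauli a * (Uᴴ * U) * pauli a * Uᴴ := by simp only [mul_assoc]
        _ = U * (pauli a * pauli a) * Uᴴ := by rw [hUU, mul_one]; simp only [mul_assoc]
        _ = 1 := by rw [pauli_mul_self, mul_one, mul_conjTranspose_self_of_mem hU.1]
    rw [h, smul_mul_smul_comm, pauli_mul_self] at h2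
    exact h2
  have hsq' : Complex.I ^ k * Complex.I ^ k = 1 := by
    have := congrFun (congrFun hsq 0) 0
    simpa using this
  obtain ⟨p, rfl⟩ := Fin.exists_succ_eq.2 hb
  rcases mul_self_eq_one_iff.1 hsq' with hk | hk
  · exact ⟨p, 1, by simp, by rw [h, hk, one_smul, one_smul]⟩
  · exact ⟨p, -1, by simp, by rw [h, hk, neg_one_smul, neg_one_smul]⟩

lemma conj_zeroState_one {U : Op 1} (hU : U ∈ cliffordGroup 1) :
    U * zeroState 1 * Uᴴ = (1 / 2 : ℝ) • (1 + U * pauli 3 * Uᴴ) := by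
  rw [zeroState_one, mul_smul_comm, smul_mul_assoc, mul_add, add_mul, mul_one,
    mul_conjTranspose_self_of_mem hU.1]

lemma exists_bloch_of_mem_pure {S : Op 1} (hS : S ∈ pureStabilizerStates 1) :
    ∃ (p : Fin 3) (s : ℝ), |s| = 1 ∧ S = bloch (Pi.single p s) := by
  obtain ⟨U, hU, rfl⟩ := hS
  obtain ⟨p, s, hs, h⟩ := exists_conj_eq_of_mem_cliffordGroup hU (a := 3) (by decide)
  exact ⟨p, s, hs, by rw [conj_zeroState_one hU, h, bloch_single]⟩

/-- The cyclic unitary carries `Z` to `X` and `X` to `Y`, so its powers reach all three axes. -/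
lemma exists_clifford_conj_eq (p : Fin 3) :
    ∃ U ∈ cliffordGroup 1, U * pauli 3 * Uᴴ = pauli p.succ := by
  have h1 := cycle_conj 3
  have h2 := cycle_conj 1
  fin_cases p
  · exact ⟨_, cycle_mem_cliffordGroup, h1⟩
  · refine ⟨_, mul_mem_cliffordGroup cycle_mem_cliffordGroup cycle_mem_cliffordGroup, ?_⟩
    calc _ = ofMatrix cycleMatrix * (ofMatrix cycleMatrix * pauli 3 * (ofMatrix cycleMatrix)ᴴ) *
        (ofMatrix cycleMatrix)ᴴ := by
          rw [Matrix.conjTranspose_mul]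
          simp only [mul_assoc]
      _ = _ := by rw [h1]; exact h2
  · refine ⟨_, pauli_mem_cliffordGroup 0, ?_⟩
    rw [pauli_zero, Matrix.conjTranspose_one, one_mul, mul_one]
    rfl

lemma pauli_one_mul_pauli_three : pauli 1 * pauli 3 * pauli 1 = - pauli 3 := by
  rw [pauli_eq, pauli_eq, ofMatrix_mul, ofMatrix_mul]
  have : pauliMatrix 1 * pauliMatrix 3 * pauliMatrix 1 = - pauliMatrix 3 := by
    ext i j
    fin_cases i <;> fin_cases j <;> simp [pauliMatrix, Matrix.mul_apply]
  rw [this]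
  rfl

lemma bloch_single_mem_pure (p : Fin 3) {s : ℝ} (hs : |s| = 1) :
    bloch (Pi.single p s) ∈ pureStabilizerStates 1 := by
  obtain ⟨U, hU, h⟩ := exists_clifford_conj_eq p
  rcases eq_or_eq_neg_of_abs_eq hs with rfl | rfl
  · exact ⟨U, hU, by rw [conj_zeroState_one hU, h, bloch_single, one_smul]⟩
  · have hUX := mul_mem_cliffordGroup hU (pauli_mem_cliffordGroup 1)
    refine ⟨_, hUX, ?_⟩
    rw [conj_zeroState_one hUX, bloch_single, neg_one_smul, Matrix.conjTranspose_mul,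
      (isHermitian_pauli 1).eq]
    have : U * pauli 1 * pauli 3 * (pauli 1 * Uᴴ) = - pauli p.succ := by
      calc _ = U * (pauli 1 * pauli 3 * pauli 1) * Uᴴ := by simp only [mul_assoc]
        _ = _ := by rw [pauli_one_mul_pauli_three, mul_neg, neg_mul, h]
    rw [this]

lemma convex_stabilizerStates (n : ℕ) : Convex ℝ (stabilizerStates n) := convex_convexHull ℝ _

lemma bloch_single_mem (p : Fin 3) {s : ℝ} (hs : |s| = 1) :
    bloch (Pi.single p s) ∈ stabilizerStates 1 :=
  subset_convexHull ℝ _ (bloch_single_mem_pure p hs)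

lemma bloch_zero_mem : bloch 0 ∈ stabilizerStates 1 := by
  have h := convex_stabilizerStates 1 (bloch_single_mem 0 (s := 1) (by simp))
    (bloch_single_mem 0 (s := -1) (by simp)) (by norm_num : (0 : ℝ) ≤ 1 / 2)
    (by norm_num : (0 : ℝ) ≤ 1 / 2) (by norm_num)
  rw [bloch_combo (by norm_num)] at h
  convert! h using 2
  ext p
  fin_cases p <;> simp

/-- The single-qubit stabilizer states form an octahedron. -/
theorem mem_stabilizerStates_one {M : Op 1} :
    M ∈ stabilizerStates 1 ↔ ∃ c : Fin 3 → ℝ, ∑ p, |c p| ≤ 1 ∧ M = bloch c := by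
  constructor
  · intro h
    refine convexHull_min (t := {M : Op 1 | ∃ c : Fin 3 → ℝ, ∑ p, |c p| ≤ 1 ∧ M = bloch c})
      ?_ ?_ h
    · intro S hS
      obtain ⟨p, s, hs, rfl⟩ := exists_bloch_of_mem_pure hS
      refine ⟨_, ?_, rfl⟩
      rw [Finset.sum_eq_single p]
      · simp [hs]
      · intro q _ hq; simp [hq]
      · simp
    · rintro _ ⟨c, hc, rfl⟩ _ ⟨d, hd, rfl⟩ a b ha hb hab
      refine ⟨_, ?_, bloch_combo hab⟩
      calc ∑ p, |(a • c + b • d) p| ≤ ∑ p, (a * |c p| + b * |d p|) := by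
            refine Finset.sum_le_sum fun p _ => ?_
            refine (abs_add_le _ _).trans (le_of_eq ?_)
            simp [abs_mul, abs_of_nonneg ha, abs_of_nonneg hb]
        _ = a * ∑ p, |c p| + b * ∑ p, |d p| := by
            rw [Finset.sum_add_distrib, Finset.mul_sum, Finset.mul_sum]
        _ ≤ a * 1 + b * 1 := by gcongr
        _ = 1 := by linarith
  · rintro ⟨c, hc, rfl⟩
    have key : ∀ p : Fin 3, ∃ s : ℝ, |s| = 1 ∧ c p = |c p| * s := by
      intro p
      rcases abs_choice (c p) with h | h
      · exact ⟨1, by simp, by rw [mul_one, h]⟩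
      · exact ⟨-1, by simp, by rw [mul_neg_one, h, neg_neg]⟩
    choose s hs hcs using key
    -- Weight `|c p|` goes to the vertex on axis `p` with the sign of `c p`; the index `none` gives
    -- the leftover weight to the centre.
    have h := (convex_stabilizerStates 1).sum_mem (t := Finset.univ)
      (w := fun o : Option (Fin 3) => o.elim (1 - ∑ p, |c p|) fun p => |c p|)
      (z := fun o => o.elim (bloch 0) fun p => bloch (Pi.single p (s p)))
      (by rintro (_ | p) _ <;> simp [hc]) (by simp [Fintype.sum_option])
      (by
        rintro (_ | p) _
        · exact bloch_zero_mem
        · exact bloch_single_mem p (hs p))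
    convert! h using 1
    simp only [Fintype.sum_option, Option.elim, bloch_single]
    have hc' : ∀ p, |c p| • (1 / 2 : ℝ) • ((1 : Op 1) + s p • pauli p.succ) =
        (1 / 2 : ℝ) • (|c p| • (1 : Op 1) + c p • pauli p.succ) := by
      intro p
      have e : c p • pauli p.succ = (|c p| * s p) • pauli p.succ := by rw [← hcs p]
      rw [e]
      module
    simp only [hc', ← Finset.smul_sum, Finset.sum_add_distrib, ← Finset.sum_smul, bloch,
      Pi.zero_apply, zero_smul, Finset.sum_const_zero]
    module

lemma zeroState_eq_tensorProd (n : ℕ) :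
    zeroState n = tensorProd fun _ : Fin n => zeroState 1 := by
  simp only [zeroState_eq, tensorProd_diagonal]
  congr 1
  ext j
  simp only [funext_iff, Finset.prod_ite_zero]
  simp

lemma tensorProd_mem_cliffordGroup {n : ℕ} {U : Fin n → Op 1}
    (hU : ∀ i, U i ∈ cliffordGroup 1) : tensorProd U ∈ cliffordGroup n := by
  refine ⟨tensorProd_mem_unitaryGroup fun i => (hU i).1, ?_⟩
  rintro _ ⟨k, a, rfl⟩
  choose l b h using fun i => mem_pauliGroup_one.1 ((hU i).2 _ (pauli_mem_pauliGroup (a i)))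
  refine ⟨k + ∑ i, l i, b, ?_⟩
  rw [mul_smul_comm, smul_mul_assoc, conjTranspose_tensorProd, tensorProd_mul, tensorProd_mul]
  simp only [h]
  rw [tensorProd_smul, smul_smul, pow_add, Finset.prod_pow_eq_pow_sum]

lemma tensorProd_mem_pure {n : ℕ} {S : Fin n → Op 1}
    (hS : ∀ i, S i ∈ pureStabilizerStates 1) : tensorProd S ∈ pureStabilizerStates n := by
  choose U hU h using hS
  refine ⟨tensorProd U, tensorProd_mem_cliffordGroup hU, ?_⟩
  rw [zeroState_eq_tensorProd, conjTranspose_tensorProd, tensorProd_mul, tensorProd_mul]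
  congr 1
  exact funext h

/-- The tensor product is linear in each factor, so factors pass from pure states to convex mixtures
one site at a time; `s` is the set of sites where mixtures are already allowed. -/
theorem tensorProd_mem_stabilizerStates {n : ℕ} {τ : Fin n → Op 1}
    (hτ : ∀ i, τ i ∈ stabilizerStates 1) : tensorProd τ ∈ stabilizerStates n := by
  suffices h : ∀ (s : Finset (Fin n)) (τ : Fin n → Op 1), (∀ i ∈ s, τ i ∈ stabilizerStates 1) →
      (∀ i ∉ s, τ i ∈ pureStabilizerStates 1) → tensorProd τ ∈ stabilizerStates n from
    h Finset.univ τ (fun i _ => hτ i) (fun i hi => absurd (Finset.mem_univ i) hi)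
  intro s
  induction s using Finset.induction_on with
  | empty =>
    intro τ _ h
    exact subset_convexHull ℝ _ (tensorProd_mem_pure fun i => h i (Finset.notMem_empty i))
  | insert a s ha ih =>
    intro τ h1 h2
    have hsub : stabilizerStates 1 ⊆ tensorProdUpdate τ a ⁻¹' stabilizerStates n := by
      refine convexHull_min (fun S hS => ?_) ((convex_stabilizerStates n).linear_preimage _)
      rw [Set.mem_preimage, tensorProdUpdate_apply]
      refine ih _ (fun i hi => ?_) (fun i hi => ?_)
      · have hia : i ≠ a := fun h => ha (h ▸ hi)
        rw [Function.update_of_ne hia]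
        exact h1 i (Finset.mem_insert_of_mem hi)
      · by_cases hia : i = a
        · subst hia
          rwa [Function.update_self]
        · rw [Function.update_of_ne hia]
          exact h2 i (by simp [hia, hi])
    have := hsub (h1 a (Finset.mem_insert_self a s))
    rwa [Set.mem_preimage, tensorProdUpdate_apply, Function.update_eq_self] at this

theorem posSemidef_of_mem_stabilizerStates {n : ℕ} {τ : Op n} (hτ : τ ∈ stabilizerStates n) :
    τ.PosSemidef := by
  refine convexHull_min (t := {M : Op n | M.PosSemidef}) ?_ ?_ hτ
  · rintro _ ⟨U, _, rfl⟩
    refine Matrix.PosSemidef.mul_mul_conjTranspose_same ?_ U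
    rw [zeroState_eq]
    refine Matrix.PosSemidef.diagonal fun j => ?_
    simp only [Pi.zero_apply]
    split_ifs <;> simp
  · intro A hA B hB a b ha hb _
    exact (hA.smul ha).add (hB.smul hb)

lemma trace_of_mem_stabilizerStates_one {τ : Op 1} (hτ : τ ∈ stabilizerStates 1) :
    τ.trace = 1 := by
  obtain ⟨c, -, rfl⟩ := mem_stabilizerStates_one.1 hτ
  simp only [bloch, Matrix.trace_smul, Matrix.trace_add, Matrix.trace_sum, Matrix.trace_one]
  simp [trace_pauli (Fin.succ_ne_zero _)]

end Clifford

/-! ### Relative entropy with positive definite second argument. -/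

section RelEntropy

variable {n : ℕ}

lemma range_mulVecLin_of_posDef {σ : Op n} (hσ : σ.PosDef) :
    LinearMap.range σ.mulVecLin = ⊤ := by
  rw [LinearMap.range_eq_top]
  intro v
  refine ⟨σ⁻¹ *ᵥ v, ?_⟩
  have := (Matrix.isUnit_iff_isUnit_det _).1 hσ.isUnit
  rw [Matrix.mulVecLin_apply, Matrix.mulVec_mulVec, Matrix.mul_nonsing_inv _ this,
    Matrix.one_mulVec]

lemma relEntropy_of_posDef (ρ : Op n) {σ : Op n} (hσ : σ.PosDef) :
    relEntropy ρ σ = (((ρ * log2 ρ).trace.re - (ρ * log2 σ).trace.re : ℝ) : EReal) := by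
  rw [relEntropy, if_pos]
  rw [range_mulVecLin_of_posDef hσ]
  exact le_top

lemma log2_eq (A : Op n) : log2 A = (Real.log 2)⁻¹ • cfc Real.log A := by
  rw [log2, ← cfc_smul (Real.log 2)⁻¹ Real.log A continuousOn_matrix]
  congr 1
  ext x
  rw [Real.logb, smul_eq_mul, div_eq_inv_mul]

lemma trace_mul_log2 (ρ A : Op n) :
    (ρ * log2 A).trace.re = (Real.log 2)⁻¹ * (ρ * cfc Real.log A).trace.re := by
  rw [log2_eq, mul_smul_comm, Matrix.trace_smul, Complex.real_smul, Complex.re_ofReal_mul]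

lemma relEntropy_le_relEntropy_iff {ρ σ τ : Op n} (hσ : σ.PosDef) (hτ : τ.PosDef) :
    relEntropy ρ σ ≤ relEntropy ρ τ ↔
      (ρ * cfc Real.log τ).trace.re ≤ (ρ * cfc Real.log σ).trace.re := by
  rw [relEntropy_of_posDef ρ hσ, relEntropy_of_posDef ρ hτ, EReal.coe_le_coe_iff,
    sub_le_sub_iff_left, trace_mul_log2, trace_mul_log2,
    mul_le_mul_iff_right₀ (inv_pos.2 (Real.log_pos one_lt_two))]

lemma posDef_spectralMatrix {m : Type*} [Fintype m] [DecidableEq m] {U : Matrix m m ℂ}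
    (hU : U ∈ Matrix.unitaryGroup m ℂ) {a : m → ℝ} (ha : ∀ i, 0 < a i) :
    (spectralMatrix U a).PosDef := by
  refine Matrix.PosDef.mul_mul_conjTranspose_same ?_ ?_
  · exact Matrix.posDef_diagonal_iff.2 fun i => by exact_mod_cast ha i
  · intro v w h
    have := congrArg (fun x => Matrix.vecMul x Uᴴ) h
    simpa [Matrix.vecMul_vecMul, mul_conjTranspose_self_of_mem hU] using this

lemma exists_eq_spectralMatrix_of_posSemidef {m : Type*} [Fintype m] [DecidableEq m]
    {A : Matrix m m ℂ} (hA : A.PosSemidef) :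
    ∃ U ∈ Matrix.unitaryGroup m ℂ, ∃ a : m → ℝ, (∀ i, 0 ≤ a i) ∧ A = spectralMatrix U a := by
  refine ⟨hA.isHermitian.eigenvectorUnitary.1, hA.isHermitian.eigenvectorUnitary.2,
    hA.isHermitian.eigenvalues, hA.eigenvalues_nonneg, ?_⟩
  conv_lhs => rw [hA.isHermitian.spectral_theorem]
  rfl

lemma conj_spectralMatrix {m : Type*} [Fintype m] [DecidableEq m] {U : Matrix m m ℂ}
    (hU : U ∈ Matrix.unitaryGroup m ℂ) (a : m → ℝ) :
    Uᴴ * spectralMatrix U a * U = Matrix.diagonal fun i => (a i : ℂ) := by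
  calc _ = (Uᴴ * U) * Matrix.diagonal (fun i => (a i : ℂ)) * (Uᴴ * U) := by
        simp only [spectralMatrix, mul_assoc]
    _ = _ := by rw [conjTranspose_mul_self_of_mem hU, one_mul, mul_one]

lemma eq_of_conj_eq {m : Type*} [Fintype m] [DecidableEq m] {U A B : Matrix m m ℂ}
    (hU : U ∈ Matrix.unitaryGroup m ℂ) (h : Uᴴ * A * U = Uᴴ * B * U) : A = B := by
  have e : ∀ M : Matrix m m ℂ, U * (Uᴴ * M * U) * Uᴴ = M := by
    intro M
    calc _ = (U * Uᴴ) * M * (U * Uᴴ) := by simp only [mul_assoc]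
      _ = M := by rw [mul_conjTranspose_self_of_mem hU, one_mul, mul_one]
  rw [← e A, h, e B]

lemma trace_conj {m : Type*} [Fintype m] [DecidableEq m] {U : Matrix m m ℂ}
    (hU : U ∈ Matrix.unitaryGroup m ℂ) (A : Matrix m m ℂ) : (Uᴴ * A * U).trace = A.trace := by
  rw [Matrix.trace_mul_comm, ← mul_assoc, mul_conjTranspose_self_of_mem hU, one_mul]

lemma isHermitian_conj {m : Type*} [Fintype m] {U A : Matrix m m ℂ} (hA : A.IsHermitian) :
    (Uᴴ * A * U).IsHermitian := Matrix.isHermitian_conjTranspose_mul_mul U hA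

lemma exists_eq_mul_of_range_le {ρ σ : Op n}
    (h : LinearMap.range ρ.mulVecLin ≤ LinearMap.range σ.mulVecLin) : ∃ W, ρ = σ * W := by
  have : ∀ k, ∃ w, σ *ᵥ w = ρ *ᵥ Pi.single k 1 := fun k => by
    have := h (LinearMap.mem_range_self ρ.mulVecLin (Pi.single k 1))
    obtain ⟨w, hw⟩ := LinearMap.mem_range.1 this
    exact ⟨w, by simpa using hw⟩
  choose w hw using this
  refine ⟨Matrix.of fun j k => w k j, ?_⟩
  ext j k
  have := congrFun (hw k) j
  rw [Matrix.mulVec_single_one] at this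
  exact this.symm

end RelEntropy

/-! ### Closest states: positivity, stationarity and noncommutation. -/

section SingleQubit

lemma bloch_zero : bloch 0 = (1 / 2 : ℝ) • (1 : Op 1) := by simp [bloch]

lemma posDef_bloch_zero : (bloch 0).PosDef := by
  rw [bloch_zero]
  exact Matrix.PosDef.one.smul (by norm_num)

/-- The maximally mixed state is a stabilizer state at finite relative entropy, so the infimum is
not `⊤`. -/
lemma range_le_of_isClosest {ρ σ : Op 1} (h : IsClosestStabilizerState ρ σ) :
    LinearMap.range ρ.mulVecLin ≤ LinearMap.range σ.mulVecLin := by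
  by_contra hn
  have h1 : relEntropy ρ σ = ⊤ := if_neg hn
  have h2 : relEntropyOfMagic ρ ≤ relEntropy ρ (bloch 0) := iInf₂_le _ bloch_zero_mem
  rw [← h.2, h1, relEntropy_of_posDef ρ posDef_bloch_zero] at h2
  exact absurd h2 (not_le.2 (EReal.coe_lt_top _))

lemma trace_bits (A : Op 1) :
    A.trace = A (fun _ => 0) (fun _ => 0) + A (fun _ => 1) (fun _ => 1) := by
  rw [Matrix.trace, sum_bits, Fin.sum_univ_two]
  rfl

lemma ext_bits {A B : Op 1} (h00 : A (fun _ => 0) (fun _ => 0) = B (fun _ => 0) (fun _ => 0))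
    (h01 : A (fun _ => 0) (fun _ => 1) = B (fun _ => 0) (fun _ => 1))
    (h10 : A (fun _ => 1) (fun _ => 0) = B (fun _ => 1) (fun _ => 0))
    (h11 : A (fun _ => 1) (fun _ => 1) = B (fun _ => 1) (fun _ => 1)) : A = B := by
  ext j k
  rw [bits_eq j, bits_eq k]
  generalize j 0 = x
  generalize k 0 = y
  fin_cases x <;> fin_cases y <;> assumption

lemma bit_zero_ne_one : (fun _ : Fin 1 => (0 : Fin 2)) ≠ fun _ => 1 :=
  fun h => absurd (congrFun h 0) (by decide)

/-- A closest stabilizer state to a single-qubit magic state is positive definite. -/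
lemma exists_spectralMatrix_of_isClosest {ρ σ : Op 1} (hρ : ρ ∈ magicStates 1)
    (h : IsClosestStabilizerState ρ σ) :
    ∃ U ∈ Matrix.unitaryGroup (Fin 1 → Fin 2) ℂ, ∃ a, (∀ i, 0 < a i) ∧
      σ = spectralMatrix U a := by
  obtain ⟨U, hU, a, ha, rfl⟩ :=
    exists_eq_spectralMatrix_of_posSemidef (posSemidef_of_mem_stabilizerStates h.1)
  refine ⟨U, hU, a, fun i => lt_of_le_of_ne (ha i) fun h0 => ?_, rfl⟩
  obtain ⟨W, hW⟩ := exists_eq_mul_of_range_le (range_le_of_isClosest h)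
  -- By the support condition, a null vector of `σ` is a null vector of `ρ`.
  have hrow : ∀ k, (Uᴴ * ρ * U) i k = 0 := by
    intro k
    have : Uᴴ * ρ * U = Matrix.diagonal (fun i => (a i : ℂ)) * (Uᴴ * W * U) := by
      rw [← conj_spectralMatrix hU]
      calc _ = Uᴴ * spectralMatrix U a * 1 * W * U := by
            rw [hW]; simp only [mul_assoc, one_mul]
        _ = _ := by rw [← mul_conjTranspose_self_of_mem hU]; simp only [mul_assoc]
    rw [this, Matrix.diagonal_mul, ← h0]
    simp
  have hcol : ∀ k, (Uᴴ * ρ * U) k i = 0 := by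
    intro k
    rw [← (isHermitian_conj (U := U) hρ.1.1.isHermitian).apply, hrow, star_zero]
  have htr : (Uᴴ * ρ * U).trace = 1 := by rw [trace_conj hU, hρ.1.2]
  have htr' : (Matrix.diagonal fun i => (a i : ℂ) : Op 1).trace = 1 := by
    rw [← conj_spectralMatrix hU, trace_conj hU, trace_of_mem_stabilizerStates_one h.1]
  -- With a common null vector and trace one, both matrices are the projector onto the other basis
  -- vector; then `ρ` would be a stabilizer state.
  have heq : Uᴴ * ρ * U = Uᴴ * spectralMatrix U a * U := by
    rw [conj_spectralMatrix hU]
    rw [trace_bits] at htr htr'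
    have hne := bit_zero_ne_one
    simp only [Matrix.diagonal_apply_eq] at htr'
    rw [bits_eq i] at hrow hcol h0
    generalize i 0 = x at hrow hcol h0
    fin_cases x
    · simp only [Fin.zero_eta, Fin.isValue] at hrow hcol h0
      rw [hrow, zero_add] at htr
      rw [← h0, Complex.ofReal_zero, zero_add] at htr'
      refine ext_bits ?_ ?_ ?_ ?_
      · rw [hrow, Matrix.diagonal_apply_eq, ← h0, Complex.ofReal_zero]
      · rw [hrow, Matrix.diagonal_apply_ne _ hne]
      · rw [hcol, Matrix.diagonal_apply_ne _ hne.symm]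
      · rw [htr, Matrix.diagonal_apply_eq, htr']
    · simp only [Fin.mk_one, Fin.isValue] at hrow hcol h0
      rw [hrow, add_zero] at htr
      rw [← h0, Complex.ofReal_zero, add_zero] at htr'
      refine ext_bits ?_ ?_ ?_ ?_
      · rw [htr, Matrix.diagonal_apply_eq, htr']
      · rw [hcol, Matrix.diagonal_apply_ne _ hne]
      · rw [hrow, Matrix.diagonal_apply_ne _ hne.symm]
      · rw [hrow, Matrix.diagonal_apply_eq, ← h0, Complex.ofReal_zero]
  exact hρ.2 (eq_of_conj_eq hU heq ▸ h.1)

/-- The state `σ` can be moved along `D` in both directions within the stabilizer states. -/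
def IsFeasible (σ D : Op 1) : Prop := σ + D ∈ stabilizerStates 1 ∧ σ - D ∈ stabilizerStates 1

lemma IsFeasible.mem {σ D : Op 1} (h : IsFeasible σ D) : σ ∈ stabilizerStates 1 := by
  have := convex_stabilizerStates 1 h.1 h.2 (by norm_num : (0 : ℝ) ≤ 1 / 2)
    (by norm_num : (0 : ℝ) ≤ 1 / 2) (by norm_num)
  convert! this using 1
  module

lemma IsFeasible.isHermitian {σ D : Op 1} (h : IsFeasible σ D) : D.IsHermitian := by
  have := (posSemidef_of_mem_stabilizerStates h.1).isHermitian.sub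
    (posSemidef_of_mem_stabilizerStates h.mem).isHermitian
  rwa [add_sub_cancel_left] at this

lemma IsFeasible.trace {σ D : Op 1} (h : IsFeasible σ D) : D.trace = 0 := by
  have := trace_of_mem_stabilizerStates_one h.1
  rw [Matrix.trace_add, trace_of_mem_stabilizerStates_one h.mem] at this
  simpa using this

lemma IsFeasible.smul {σ D : Op 1} (h : IsFeasible σ D) {t : ℝ} (ht : |t| ≤ 1) :
    IsFeasible σ (t • D) := by
  have key : ∀ t : ℝ, |t| ≤ 1 → σ + t • D ∈ stabilizerStates 1 := by
    intro t ht
    obtain ⟨h1, h2⟩ := abs_le.1 ht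
    have := convex_stabilizerStates 1 h.1 h.2 (by linarith : (0 : ℝ) ≤ (1 + t) / 2)
      (by linarith : (0 : ℝ) ≤ (1 - t) / 2) (by ring)
    convert! this using 1
    module
  refine ⟨key t ht, ?_⟩
  have := key (-t) (by rwa [abs_neg])
  rwa [neg_smul, ← sub_eq_add_neg] at this

/-- The matrix is `(1 - t) • σ + t • (σ + D)`, whose first term is positive definite. -/
lemma posDef_add_smul {n : ℕ} {σ D : Op n} (hσ : σ.PosDef) (h : (σ + D).PosSemidef) {t : ℝ}
    (ht0 : 0 ≤ t) (ht : t < 1) : (σ + t • D).PosDef := by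
  have := (hσ.smul (by linarith : 0 < 1 - t)).add_posSemidef (h.smul ht0)
  convert! this using 1
  module

lemma IsFeasible.neg {σ D : Op 1} (h : IsFeasible σ D) : IsFeasible σ (-D) :=
  ⟨by rw [← sub_eq_add_neg]; exact h.2, by rw [sub_neg_eq_add]; exact h.1⟩

lemma IsFeasible.posDef_add_smul {σ D : Op 1} (h : IsFeasible σ D) (hσ : σ.PosDef) {t : ℝ}
    (ht : |t| < 1) : (σ + t • D).PosDef := by
  rcases le_total 0 t with h0 | h0
  · rw [abs_of_nonneg h0] at ht
    exact Magic.posDef_add_smul hσ (posSemidef_of_mem_stabilizerStates h.1) h0 ht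
  · rw [abs_of_nonpos h0] at ht
    have := Magic.posDef_add_smul hσ (posSemidef_of_mem_stabilizerStates h.neg.1)
      (neg_nonneg.2 h0) ht
    rwa [smul_neg, neg_smul, neg_neg] at this

/-- First-order optimality of a closest stabilizer state. -/
lemma sum_eq_zero_of_isFeasible {ρ U D : Op 1} {a : (Fin 1 → Fin 2) → ℝ}
    (hU : U ∈ Matrix.unitaryGroup (Fin 1 → Fin 2) ℂ) (ha : ∀ i, 0 < a i)
    (hcl : IsClosestStabilizerState ρ (spectralMatrix U a))
    (hD : IsFeasible (spectralMatrix U a) D) :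
    ∑ j, ∑ k, dslope Real.log (a j) (a k) *
      ((Uᴴ * ρ * U) k j * (Uᴴ * D * U) j k).re = 0 := by
  -- Feasibility in both directions makes zero an interior maximum, which gives an equality instead
  -- of a one-sided inequality.
  refine IsLocalMax.hasDerivAt_eq_zero ?_ (hasDerivAt_trace_mul_cfc_log hU ha hD.isHermitian ρ)
  have hball : {t : ℝ | |t| < 1} ∈ 𝓝 (0 : ℝ) :=
    (isOpen_lt continuous_abs continuous_const).mem_nhds (by simp)
  filter_upwards [hball] with t ht
  have ht : |t| < 1 := ht
  have hσ := posDef_spectralMatrix hU ha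
  rw [zero_smul, add_zero, ← relEntropy_le_relEntropy_iff hσ (hD.posDef_add_smul hσ ht), hcl.2]
  exact iInf₂_le _ (hD.smul ht.le).1

lemma commute_of_conj {ρ U : Op 1} {a : (Fin 1 → Fin 2) → ℝ}
    (hU : U ∈ Matrix.unitaryGroup (Fin 1 → Fin 2) ℂ)
    (h : ∀ j k, (Uᴴ * ρ * U) j k * a k = a j * (Uᴴ * ρ * U) j k) :
    Commute ρ (spectralMatrix U a) := by
  have h1 : (Uᴴ * ρ * U) * Matrix.diagonal (fun i => (a i : ℂ)) =
      Matrix.diagonal (fun i => (a i : ℂ)) * (Uᴴ * ρ * U) := by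
    ext j k
    rw [Matrix.diagonal_mul, Matrix.mul_diagonal, h]
  refine eq_of_conj_eq hU ?_
  rw [← conj_spectralMatrix hU] at h1
  have hUU := mul_conjTranspose_self_of_mem hU
  calc _ = Uᴴ * ρ * 1 * spectralMatrix U a * U := by simp only [mul_assoc, one_mul]
    _ = (Uᴴ * ρ * U) * (Uᴴ * spectralMatrix U a * U) := by
      rw [← hUU]; simp only [mul_assoc]
    _ = Uᴴ * spectralMatrix U a * (U * Uᴴ) * ρ * U := by rw [h1]; simp only [mul_assoc]
    _ = _ := by rw [hUU]; simp only [mul_assoc, one_mul]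

lemma ne_of_not_commute {ρ U : Op 1} {a : (Fin 1 → Fin 2) → ℝ}
    (hU : U ∈ Matrix.unitaryGroup (Fin 1 → Fin 2) ℂ)
    (h : ¬ Commute ρ (spectralMatrix U a)) : a (fun _ => 0) ≠ a (fun _ => 1) := by
  intro h0
  refine h (commute_of_conj hU fun j k => ?_)
  have : ∀ j : Fin 1 → Fin 2, a j = a (fun _ => 0) := by
    intro j
    rw [bits_eq j]
    generalize j 0 = x
    fin_cases x
    · rfl
    · exact h0.symm
  rw [this j, this k, mul_comm]

lemma offDiag_ne_zero_of_not_commute {ρ U : Op 1} {a : (Fin 1 → Fin 2) → ℝ}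
    (hρ : ρ.IsHermitian) (hU : U ∈ Matrix.unitaryGroup (Fin 1 → Fin 2) ℂ)
    (h : ¬ Commute ρ (spectralMatrix U a)) : (Uᴴ * ρ * U) (fun _ => 1) (fun _ => 0) ≠ 0 := by
  intro h0
  have h1 : (Uᴴ * ρ * U) (fun _ => 0) (fun _ => 1) = 0 := by
    rw [← (isHermitian_conj (U := U) hρ).apply, h0, star_zero]
  refine h (commute_of_conj hU fun j k => ?_)
  rw [bits_eq j, bits_eq k]
  generalize j 0 = x
  generalize k 0 = y
  fin_cases x <;> fin_cases y <;> simp [h0, h1, mul_comm]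

/-- Traceless Hermitian matrices that are diagonal in the eigenbasis form a real line, spanned by
the radial direction `σ - bloch 0` when the eigenvalues differ. -/
lemma exists_eq_smul_of_offDiag_eq_zero {U D : Op 1} {a : (Fin 1 → Fin 2) → ℝ}
    (hU : U ∈ Matrix.unitaryGroup (Fin 1 → Fin 2) ℂ) (hD : D.IsHermitian) (htr : D.trace = 0)
    (ha : a (fun _ => 0) ≠ a (fun _ => 1)) (hsum : (spectralMatrix U a).trace = 1)
    (h : (Uᴴ * D * U) (fun _ => 0) (fun _ => 1) = 0) :
    ∃ c : ℝ, D = c • (spectralMatrix U a - bloch 0) := by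
  have hH := isHermitian_conj (U := U) hD
  have h10 : (Uᴴ * D * U) (fun _ => 1) (fun _ => 0) = 0 := by
    rw [← hH.apply, h, star_zero]
  have htr' : (Uᴴ * D * U).trace = 0 := by rw [trace_conj hU, htr]
  rw [trace_bits] at htr'
  obtain ⟨d, hd⟩ : ∃ d : ℝ, (Uᴴ * D * U) (fun _ => 0) (fun _ => 0) = d :=
    ⟨_, (Complex.conj_eq_iff_re.1 (hH.apply _ _)).symm⟩
  have hs : a (fun _ => 0) + a (fun _ => 1) = 1 := by
    rw [← trace_conj hU, conj_spectralMatrix hU, trace_bits, Matrix.diagonal_apply_eq,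
      Matrix.diagonal_apply_eq] at hsum
    exact_mod_cast hsum
  have hne : a (fun _ => 0) - a (fun _ => 1) ≠ 0 := sub_ne_zero.2 ha
  -- In the eigenbasis `D` is `diag(d, -d)`, and the radial direction is `diag(1, -1)` times half
  -- the eigenvalue gap.
  refine ⟨2 * d / (a (fun _ => 0) - a (fun _ => 1)), eq_of_conj_eq hU ?_⟩
  have e : Uᴴ * ((2 * d / (a (fun _ => 0) - a (fun _ => 1))) •
      (spectralMatrix U a - bloch 0)) * U = (2 * d / (a (fun _ => 0) - a (fun _ => 1))) •
      (Matrix.diagonal (fun i => (a i : ℂ)) - (1 / 2 : ℝ) • (1 : Op 1)) := by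
    rw [mul_smul_comm, smul_mul_assoc, mul_sub, sub_mul, conj_spectralMatrix hU, bloch_zero,
      mul_smul_comm, mul_one, smul_mul_assoc, conjTranspose_mul_self_of_mem hU]
  rw [e]
  have hb := bit_zero_ne_one
  have hne' : (a (fun _ => 0) : ℂ) - a (fun _ => 1) ≠ 0 := by exact_mod_cast hne
  have hs' : (a (fun _ => 1) : ℂ) = 1 - a (fun _ => 0) := by
    rw [eq_sub_iff_add_eq']
    exact_mod_cast hs
  rw [hs'] at hne'
  refine ext_bits ?_ ?_ ?_ ?_
  · rw [hd]
    simp [hs']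
    field_simp
    ring
  · rw [h]; simp [hb]
  · rw [h10]; simp [hb.symm]
  · rw [← neg_eq_of_add_eq_zero_right htr', hd]
    simp [hs']
    field_simp
    ring

end SingleQubit

/-! ### Feasible directions in the octahedron and their coherences. -/

section Directions

lemma trace_pauli_mul_pauli (p q : Fin 3) :
    (pauli p.succ * pauli q.succ).trace = if p = q then 2 else 0 := by
  rw [pauli_eq, pauli_eq, ofMatrix_mul, trace_ofMatrix]
  fin_cases p <;> fin_cases q <;>
    simp [pauliMatrix, Matrix.trace] <;> norm_num

lemma trace_pauli_mul_bloch (p : Fin 3) (c : Fin 3 → ℝ) :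
    (pauli p.succ * bloch c).trace = c p := by
  simp only [bloch, mul_smul_comm, mul_add, mul_one, Finset.mul_sum, Matrix.trace_smul,
    Matrix.trace_add, Matrix.trace_sum, trace_pauli (Fin.succ_ne_zero _), trace_pauli_mul_pauli]
  simp [mul_comm (c p : ℂ)]

lemma bloch_injective : Function.Injective bloch := by
  intro c d h
  ext p
  have := trace_pauli_mul_bloch p c
  rw [h, trace_pauli_mul_bloch] at this
  exact_mod_cast this.symm

/-- An invertible idempotent is the identity, whose trace is two instead of one. -/
lemma not_posDef_bloch_single (p : Fin 3) {s : ℝ} (hs : |s| = 1) :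
    ¬ (bloch (Pi.single p s)).PosDef := by
  intro h
  have hidem : bloch (Pi.single p s) * bloch (Pi.single p s) = bloch (Pi.single p s) := by
    rw [bloch_single, smul_mul_smul_comm, mul_add, add_mul, add_mul, one_mul, one_mul, mul_one,
      smul_mul_smul_comm, pauli_mul_self, ← abs_mul_abs_self s, hs]
    module
  have h1 : bloch (Pi.single p s) = 1 := by
    have := h.isUnit.mul_left_cancel (hidem.trans (mul_one _).symm)
    exact this
  have h2 := trace_of_mem_stabilizerStates_one (bloch_single_mem p hs)
  rw [h1, Matrix.trace_one] at h2
  simp at h2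

/-- A point of the octahedron other than the origin and the vertices can be moved in both
directions along some line that does not contain the origin. -/
lemma exists_direction_octahedron {c : Fin 3 → ℝ} (hc : ∑ p, |c p| ≤ 1) (h0 : c ≠ 0)
    (hv : ∀ p s, |s| = 1 → c ≠ Pi.single p s) :
    ∃ d : Fin 3 → ℝ, ∑ p, |c p + d p| ≤ 1 ∧ ∑ p, |c p - d p| ≤ 1 ∧ ∀ k : ℝ, d ≠ k • c := by
  obtain ⟨p, hp⟩ := Function.ne_iff.1 h0
  simp only [Pi.zero_apply] at hp
  have hsgn : ∀ p : Fin 3, ∃ s : ℝ, |s| = 1 ∧ c p = |c p| * s := by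
    intro p
    rcases abs_choice (c p) with h | h
    · exact ⟨1, by simp, by rw [mul_one, h]⟩
    · exact ⟨-1, by simp, by rw [mul_neg_one, h, neg_neg]⟩
  choose s hs hcs using hsgn
  have hs0 : ∀ p, s p ≠ 0 := fun p h => by
    have := hs p
    rw [h] at this
    simp at this
  by_cases h : ∃ q, q ≠ p ∧ c q ≠ 0
  · obtain ⟨q, hqp, hq⟩ := h
    -- With two nonzero coordinates, `ℓ¹` mass `m` is shifted between them; no coordinate changes
    -- sign, so the norm is preserved.
    set m := min |c p| |c q|
    have hm0 : 0 < m := lt_min (abs_pos.2 hp) (abs_pos.2 hq)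
    have hmp : m ≤ |c p| := min_le_left _ _
    have hmq : m ≤ |c q| := min_le_right _ _
    have habs : ∀ i t, |t| ≤ |c i| → |c i + t * s i| = |c i| + t := by
      intro i t ht
      conv_lhs => rw [hcs i]
      rw [← add_mul, abs_mul, hs, mul_one, abs_of_nonneg]
      linarith [(abs_le.1 ht).1]
    set d : Fin 3 → ℝ := Pi.single p (m * s p) - Pi.single q (m * s q) with hd
    have hdp : d p = m * s p := by simp [hd, hqp.symm]
    have hdq : d q = -(m * s q) := by simp [hd, hqp]
    have hdo : ∀ i, i ≠ p → i ≠ q → d i = 0 := fun i h1 h2 => by simp [hd, h1, h2]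
    have key : ∀ t : ℝ, |t| = 1 → ∑ i, |c i + t * d i| ≤ 1 := by
      intro t ht
      have : ∀ i, |c i + t * d i| =
          |c i| + (Pi.single p (t * m) - Pi.single q (t * m) : Fin 3 → ℝ) i := by
        intro i
        by_cases hip : i = p
        · subst hip
          rw [hdp, ← mul_assoc, habs _ _ (by rw [abs_mul, ht, one_mul, abs_of_pos hm0]; exact hmp)]
          simp [hqp.symm]
        · by_cases hiq : i = q
          · subst hiq
            rw [hdq, show t * -(m * s i) = (-(t * m)) * s i by ring,
              habs _ _ (by rw [abs_neg, abs_mul, ht, one_mul, abs_of_pos hm0]; exact hmq)]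
            simp [hqp]
          · rw [hdo i hip hiq]
            simp [hip, hiq]
      simp only [this, Finset.sum_add_distrib, Pi.sub_apply, Finset.sum_sub_distrib]
      simpa using hc
    refine ⟨d, by simpa using key 1 (by simp), ?_, ?_⟩
    · simpa [← sub_eq_add_neg] using key (-1) (by simp)
    · intro k hk
      have h1 : d p = k * c p := by rw [hk]; rfl
      have h2 : d q = k * c q := by rw [hk]; rfl
      rw [hdp, hcs p, ← mul_assoc] at h1
      rw [hdq, hcs q, ← mul_assoc, ← neg_mul] at h2
      have h1 := mul_right_cancel₀ (hs0 p) h1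
      have h2 := mul_right_cancel₀ (hs0 q) h2
      -- Proportionality to `c` would require `m = k * |c p|` and `-m = k * |c q|`, which give `k`
      -- opposite signs.
      have hk : 0 < k := by
        by_contra hk
        nlinarith [abs_nonneg (c p)]
      nlinarith [abs_nonneg (c q)]
  -- With a single nonzero coordinate, not being a vertex leaves slack `1 - |c p|` for another axis.
  · push Not at h
    have hcp : c = Pi.single p (c p) := by
      ext i
      by_cases hip : i = p
      · subst hip; simp
      · simp [hip, h i hip]
    have hsum : ∑ i, |c i| = |c p| := by
      rw [Finset.sum_eq_single p]
      · intro i _ hi; simp [h i hi]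
      · simp
    have hlt : |c p| < 1 := lt_of_le_of_ne (hsum ▸ hc) fun h1 => hv p (c p) h1 hcp
    obtain ⟨q, hqp⟩ : ∃ q, q ≠ p := exists_ne p
    have key : ∀ t : ℝ, |t| = 1 →
        ∑ i, |c i + t * (Pi.single q (1 - |c p|) : Fin 3 → ℝ) i| ≤ 1 := by
      intro t ht
      have : ∀ i, |c i + t * (Pi.single q (1 - |c p|) : Fin 3 → ℝ) i| =
          |c i| + (Pi.single q (1 - |c p|) : Fin 3 → ℝ) i := by
        intro i
        by_cases hiq : i = q
        · subst hiq
          rw [h i hqp, Pi.single_eq_same, zero_add, abs_mul, ht, one_mul, abs_zero, zero_add,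
            abs_of_pos (by linarith)]
        · simp [hiq]
      simp only [this, Finset.sum_add_distrib, hsum]
      simp
    refine ⟨Pi.single q (1 - |c p|), by simpa using key 1 (by simp), ?_, ?_⟩
    · simpa [← sub_eq_add_neg] using key (-1) (by simp)
    · intro k hk
      have := congrFun hk q
      rw [Pi.single_eq_same, Pi.smul_apply, h q hqp, smul_zero] at this
      linarith

/-- The off-diagonal element of the product of `ρ` and the transpose of `D` entry by entry in the
basis `U`. -/
noncomputable def coherence (ρ U : Op 1) : Op 1 →ₗ[ℝ] ℂ where
  toFun D := (Uᴴ * ρ * U) (fun _ => 1) (fun _ => 0) * (Uᴴ * D * U) (fun _ => 0) (fun _ => 1)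
  map_add' D E := by rw [mul_add, add_mul, Matrix.add_apply, mul_add]
  map_smul' r D := by
    rw [mul_smul_comm, smul_mul_assoc, Matrix.smul_apply, mul_smul_comm, RingHom.id_apply]

lemma coherence_apply (ρ U D : Op 1) : coherence ρ U D =
    (Uᴴ * ρ * U) (fun _ => 1) (fun _ => 0) * (Uᴴ * D * U) (fun _ => 0) (fun _ => 1) := rfl

variable {ρ U : Op 1} {a : (Fin 1 → Fin 2) → ℝ}

/-- Noncommutation makes the off-diagonal entry of `ρ` nonzero, so that of `D` vanishes: only radial
directions lack coherence. -/
lemma exists_eq_smul_of_coherence_eq_zero (hρ : ρ.IsHermitian)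
    (hU : U ∈ Matrix.unitaryGroup (Fin 1 → Fin 2) ℂ)
    (hnc : ¬ Commute ρ (spectralMatrix U a)) {D : Op 1} (hD : IsFeasible (spectralMatrix U a) D)
    (h : coherence ρ U D = 0) : ∃ c : ℝ, D = c • (spectralMatrix U a - bloch 0) := by
  rw [coherence_apply] at h
  exact exists_eq_smul_of_offDiag_eq_zero hU hD.isHermitian hD.trace (ne_of_not_commute hU hnc)
    (trace_of_mem_stabilizerStates_one hD.mem)
    ((mul_eq_zero.1 h).resolve_left (offDiag_ne_zero_of_not_commute hρ hU hnc))

/-- The state is not the centre, which commutes with everything, nor a vertex, which is singular.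
Hence a nonradial feasible direction exists, and it has nonzero coherence. -/
lemma exists_isFeasible_coherence_ne_zero (hρ : ρ.IsHermitian)
    (hU : U ∈ Matrix.unitaryGroup (Fin 1 → Fin 2) ℂ) (ha : ∀ i, 0 < a i)
    (hσ : spectralMatrix U a ∈ stabilizerStates 1)
    (hnc : ¬ Commute ρ (spectralMatrix U a)) :
    ∃ D, IsFeasible (spectralMatrix U a) D ∧ coherence ρ U D ≠ 0 := by
  obtain ⟨c, hc, hcσ⟩ := mem_stabilizerStates_one.1 hσ
  have h0 : c ≠ 0 := by
    rintro rfl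
    apply hnc
    rw [hcσ, bloch_zero]
    exact (Commute.one_right ρ).smul_right _
  have hv : ∀ p s, |s| = 1 → c ≠ Pi.single p s := by
    rintro p s hs rfl
    exact not_posDef_bloch_single p hs (hcσ ▸ posDef_spectralMatrix hU ha)
  obtain ⟨d, h1, h2, h3⟩ := exists_direction_octahedron hc h0 hv
  have hD : IsFeasible (spectralMatrix U a) (bloch d - bloch 0) := by
    have e1 := bloch_add_smul c d 1
    have e2 := bloch_add_smul c d (-1)
    rw [one_smul, one_smul] at e1
    rw [neg_one_smul, neg_one_smul, ← sub_eq_add_neg, ← sub_eq_add_neg] at e2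
    constructor
    · rw [hcσ, ← e1]
      exact mem_stabilizerStates_one.2 ⟨_, h1, rfl⟩
    · rw [hcσ, ← e2]
      exact mem_stabilizerStates_one.2 ⟨_, h2, rfl⟩
  refine ⟨_, hD, fun hz => ?_⟩
  obtain ⟨k, hk⟩ := exists_eq_smul_of_coherence_eq_zero hρ hU hnc hD hz
  apply h3 k
  apply bloch_injective
  have e := bloch_add_smul 0 c k
  rw [zero_add] at e
  rw [e, ← hcσ, ← hk]
  abel

/-- The line through `σ` along `D` stays in the affine span, and the relative interior pulls back to
an open neighbourhood of zero on it. -/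
lemma exists_pos_mem_of_mem_intrinsicInterior {n : ℕ} {A : Set (Op n)} {σ D : Op n}
    (hσ : σ ∈ intrinsicInterior ℝ A) (hD : D ∈ vectorSpan ℝ A) :
    ∃ ε > (0 : ℝ), σ + ε • D ∈ A ∧ σ - ε • D ∈ A := by
  obtain ⟨x, hx, rfl⟩ := hσ
  have hdir : ∀ t : ℝ, (x : Op n) + t • D ∈ affineSpan ℝ A := by
    intro t
    rw [add_comm]
    refine AffineSubspace.vadd_mem_of_mem_direction ?_ x.2
    rw [direction_affineSpan]
    exact Submodule.smul_mem _ t hD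
  let γ : ℝ → affineSpan ℝ A := fun t => ⟨(x : Op n) + t • D, hdir t⟩
  have hγ : Continuous γ := by
    refine Continuous.subtype_mk ?_ _
    fun_prop
  have h0 : γ 0 = x := by ext; simp [γ]
  have hmem : γ ⁻¹' interior ((↑) ⁻¹' A : Set (affineSpan ℝ A)) ∈ 𝓝 (0 : ℝ) :=
    (isOpen_interior.preimage hγ).mem_nhds (by rw [Set.mem_preimage, h0]; exact hx)
  obtain ⟨ε, hε, hball⟩ := Metric.mem_nhds_iff.1 hmem
  have key : ∀ t : ℝ, |t| < ε → (x : Op n) + t • D ∈ A := fun t ht =>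
    (interior_subset : interior ((↑) ⁻¹' A : Set (affineSpan ℝ A)) ⊆ _)
      (hball (by simpa using ht : t ∈ Metric.ball (0 : ℝ) ε))
  refine ⟨ε / 2, by positivity, key _ (by rw [abs_of_pos] <;> linarith), ?_⟩
  have := key (-(ε / 2)) (by rw [abs_neg, abs_of_pos] <;> linarith)
  rwa [neg_smul, ← sub_eq_add_neg] at this

lemma three_le_finrank_vectorSpan :
    3 ≤ Module.finrank ℝ (vectorSpan ℝ (stabilizerStates 1)) := by
  have hmem : ∀ p : Fin 3, pauli p.succ ∈ vectorSpan ℝ (stabilizerStates 1) := by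
    intro p
    have := vsub_mem_vectorSpan ℝ (bloch_single_mem p (s := 1) (by simp))
      (bloch_single_mem p (s := -1) (by simp))
    rw [bloch_single, bloch_single, vsub_eq_sub] at this
    convert! this using 1
    module
  have hli : LinearIndependent ℝ fun p : Fin 3 =>
      (⟨pauli p.succ, hmem p⟩ : vectorSpan ℝ (stabilizerStates 1)) := by
    rw [Fintype.linearIndependent_iff]
    intro g hg p
    have h1 : ∑ p, g p • pauli p.succ = 0 := by
      have := congrArg Subtype.val hg
      simpa using this
    have h2 : bloch g = bloch 0 := by
      rw [bloch, h1, add_zero, bloch_zero]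
    exact congrFun (bloch_injective h2) p
  simpa using hli.fintype_card_le_finrank

lemma two_smul_bloch_zero_sub_mem {τ : Op 1} (hτ : τ ∈ stabilizerStates 1) :
    (2 : ℝ) • bloch 0 - τ ∈ stabilizerStates 1 := by
  obtain ⟨c, hc, rfl⟩ := mem_stabilizerStates_one.1 hτ
  refine mem_stabilizerStates_one.2 ⟨-c, by simpa using hc, ?_⟩
  have := bloch_add_smul 0 c (-1)
  rw [zero_add, neg_one_smul] at this
  rw [this]
  module

/-- A facet of the octahedron does not contain the direction towards the centre. -/
lemma not_smul_mem_vectorSpan_of_isFacet {A : Set (Op 1)} (hA : IsFacet (stabilizerStates 1) A)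
    {σ : Op 1} (hσ : σ ∈ A) {c : ℝ} (hc : c ≠ 0) :
    c • (σ - bloch 0) ∉ vectorSpan ℝ A := by
  intro hmem
  obtain ⟨l, hl⟩ := hA.2.1 hA.1
  have hconst : ∀ x ∈ A, ∀ y ∈ A, l x = l y := by
    intro x hx y hy
    rw [hl] at hx hy
    exact le_antisymm (hy.2 x hx.1) (hx.2 y hy.1)
  have hker : vectorSpan ℝ A ≤ LinearMap.ker (l : Op 1 →ₗ[ℝ] ℝ) := by
    rw [vectorSpan, Submodule.span_le]
    rintro _ ⟨x, hx, y, hy, rfl⟩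
    simp [hconst x hx y hy]
  -- The functional exposing `A` is constant on `A`, so it vanishes on the direction space and in
  -- particular on the radial direction.
  have h1 : l σ = l (bloch 0) := by
    have := hker hmem
    rw [LinearMap.mem_ker] at this
    have h2 : c * (l σ - l (bloch 0)) = 0 := by simpa using this
    exact sub_eq_zero.1 ((mul_eq_zero.1 h2).resolve_left hc)
  have hσ' := hσ
  rw [hl] at hσ'
  -- The functional now attains its maximum at the centre of symmetry, hence everywhere; then `A` is
  -- the whole octahedron, against codimension one.
  have hsub : stabilizerStates 1 ⊆ A := by
    intro y hy
    rw [hl]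
    refine ⟨hy, fun z hz => (hσ'.2 z hz).trans ?_⟩
    have := hσ'.2 _ (two_smul_bloch_zero_sub_mem hy)
    rw [map_sub, map_smul, smul_eq_mul] at this
    linarith
  have heq : A = stabilizerStates 1 := by
    refine Set.Subset.antisymm ?_ hsub
    rw [hl]
    exact fun x hx => hx.1
  have := hA.2.2
  rw [heq] at this
  omega

/-- The kernel of the coherence is radial and the facet contains no radial direction, so the
coherence is injective on the direction space of the facet. That space has real dimension at least
two, so the coherence maps onto `ℂ`. The scale `ε` is needed because only short steps stay in the
facet. -/
lemma exists_isFeasible_coherence_eq (hρ : ρ.IsHermitian)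
    (hU : U ∈ Matrix.unitaryGroup (Fin 1 → Fin 2) ℂ)
    (hnc : ¬ Commute ρ (spectralMatrix U a)) {A : Set (Op 1)}
    (hA : IsFacet (stabilizerStates 1) A) (hσ : spectralMatrix U a ∈ intrinsicInterior ℝ A)
    (z : ℂ) :
    ∃ D, IsFeasible (spectralMatrix U a) D ∧ ∃ ε > (0 : ℝ), coherence ρ U D = ε • z := by
  have hsub : A ⊆ stabilizerStates 1 := by
    obtain ⟨l, hl⟩ := hA.2.1 hA.1
    rw [hl]
    exact fun x hx => hx.1
  have hfeas : ∀ D ∈ vectorSpan ℝ A, ∃ ε > (0 : ℝ), IsFeasible (spectralMatrix U a) (ε • D) := by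
    intro D hD
    obtain ⟨ε, hε, h1, h2⟩ := exists_pos_mem_of_mem_intrinsicInterior hσ hD
    exact ⟨ε, hε, hsub h1, hsub h2⟩
  let κ : vectorSpan ℝ A →ₗ[ℝ] ℂ := (coherence ρ U).domRestrict (vectorSpan ℝ A)
  have hinj : LinearMap.ker κ = ⊥ := by
    rw [LinearMap.ker_eq_bot']
    rintro ⟨D, hD⟩ h0
    have h0 : coherence ρ U D = 0 := h0
    obtain ⟨ε, hε, hf⟩ := hfeas D hD
    obtain ⟨c, hc⟩ := exists_eq_smul_of_coherence_eq_zero hρ hU hnc hf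
      (by rw [map_smul, h0, smul_zero])
    by_cases hc0 : c = 0
    · rw [hc0, zero_smul] at hc
      ext1
      exact (smul_eq_zero.1 hc).resolve_left hε.ne'
    · exact absurd (hc ▸ Submodule.smul_mem _ ε hD)
        (not_smul_mem_vectorSpan_of_isFacet hA (intrinsicInterior_subset hσ) hc0)
  have hsurj : LinearMap.range κ = ⊤ := by
    apply Submodule.eq_top_of_finrank_eq
    have h1 := LinearMap.finrank_range_of_inj (LinearMap.ker_eq_bot.1 hinj)
    have h2 := Submodule.finrank_le (LinearMap.range κ)
    have h3 := hA.2.2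
    have h4 := three_le_finrank_vectorSpan
    have h5 := Complex.finrank_real_complex
    omega
  obtain ⟨⟨D, hD⟩, hDz⟩ := LinearMap.range_eq_top.1 hsurj z
  obtain ⟨ε, hε, hf⟩ := hfeas D hD
  refine ⟨_, hf, ε, hε, ?_⟩
  rw [map_smul]
  exact congrArg _ hDz

end Directions

/-! ### Additivity of the entropic terms on product states. -/

section Additivity

variable {n : ℕ}

lemma trace_tensorProd_mul_cfc_log {ρ U : Fin n → Op 1} {a : Fin n → (Fin 1 → Fin 2) → ℝ}
    (hU : ∀ i, U i ∈ Matrix.unitaryGroup (Fin 1 → Fin 2) ℂ) (hρ : ∀ i, (ρ i).trace = 1)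
    (h0 : ∀ i j, a i j = 0 → ((U i)ᴴ * ρ i * U i) j j = 0) :
    (tensorProd ρ * cfc Real.log (tensorProd fun i => spectralMatrix (U i) (a i))).trace =
      ∑ i, (ρ i * cfc Real.log (spectralMatrix (U i) (a i))).trace := by
  have hsum : ∀ i, ∑ x : Fin 2, ((U i)ᴴ * ρ i * U i) (fun _ => x) (fun _ => x) = 1 := by
    intro i
    rw [← hρ i, ← trace_conj (hU i), Matrix.trace, sum_bits]
    rfl
  rw [tensorProd_spectralMatrix, cfc_spectralMatrix (tensorProd_mem_unitaryGroup hU),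
    trace_mul_spectralMatrix, conj_tensorProd]
  have hterm : ∀ j : Fin n → Fin 2,
      tensorProd (fun i => (U i)ᴴ * ρ i * U i) j j *
        ((Real.log (∏ i, a i fun _ => j i) : ℝ) : ℂ) =
      ∑ i, ((Real.log (a i fun _ => j i) : ℝ) : ℂ) *
        ∏ k, ((U k)ᴴ * ρ k * U k) (fun _ => j k) (fun _ => j k) := by
    intro j
    rw [tensorProd_apply, ← Finset.sum_mul, mul_comm]
    -- The logarithm of a product splits only for nonzero factors. If an eigenvalue vanishes, so
    -- does the weight by `h0`; thus singular `ρ` is covered as well.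
    by_cases h : ∀ i, (a i fun _ => j i) ≠ 0
    · rw [Real.log_prod fun i _ => h i, Complex.ofReal_sum]
    · push Not at h
      obtain ⟨i, hi⟩ := h
      have hz : ∏ k, ((U k)ᴴ * ρ k * U k) (fun _ => j k) (fun _ => j k) = 0 :=
        Finset.prod_eq_zero (Finset.mem_univ i) (h0 i _ hi)
      rw [hz, mul_zero, mul_zero]
  simp only [hterm]
  rw [Finset.sum_comm]
  refine Finset.sum_congr rfl fun i _ => ?_
  rw [cfc_spectralMatrix (hU i), trace_mul_spectralMatrix, sum_bits]
  rw [sum_mul_prod_of_sum_eq_one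
    (fun k x => ((U k)ᴴ * ρ k * U k) (fun _ => x) (fun _ => x)) i (fun k _ => hsum k)
    (fun x => ((Real.log (a i fun _ => x) : ℝ) : ℂ))]
  exact Finset.sum_congr rfl fun x _ => mul_comm _ _

lemma trace_tensorProd_mul_log_self {ρ : Fin n → Op 1} (hρ : ∀ i, ρ i ∈ densityMatrices 1) :
    (tensorProd ρ * cfc Real.log (tensorProd ρ)).trace =
      ∑ i, (ρ i * cfc Real.log (ρ i)).trace := by
  choose U hU a _ h using fun i => exists_eq_spectralMatrix_of_posSemidef (hρ i).1
  obtain rfl : ρ = fun i => spectralMatrix (U i) (a i) := funext h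
  refine trace_tensorProd_mul_cfc_log hU (fun i => (hρ i).2) fun i j h0 => ?_
  rw [conj_spectralMatrix (hU i), Matrix.diagonal_apply_eq, h0, Complex.ofReal_zero]

end Additivity

/-! ### The surviving off-diagonal terms for two qubits. -/

section TwoQubit

open Real

/-- The derivative of the entropic functional at a product of two qubits, in terms of the
off-diagonal elements, if the first factor is stationary. -/
lemma two_qubit_sum {x y : Fin 2 → ℝ} (hx : ∀ j, 0 < x j) (hy : ∀ j, 0 < y j)
    {M N : Fin 2 → Fin 2 → ℂ}
    (hM₀ : (M 0 0).im = 0) (hM₁ : (M 1 1).im = 0) (hM : M 1 0 = star (M 0 1))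
    (hN₀ : (N 0 0).im = 0) (hN₁ : (N 1 1).im = 0) (hN : N 1 0 = star (N 0 1))
    (hopt : ∑ j, ∑ k, dslope log (x j) (x k) * (M j k).re = 0) :
    ∑ j, ∑ k, ∑ j', ∑ k', dslope log (x j * y j') (x k * y k') *
      (M j k * N j' k').re =
    2 * (M 0 1).re * (N 0 1).re * (dslope log (x 0 * y 0) (x 1 * y 1) +
        dslope log (x 0 * y 1) (x 1 * y 0) - 2 * (dslope log (x 0) (x 1) * dslope log (y 0) (y 1))) +
      2 * (M 0 1).im * (N 0 1).im * (dslope log (x 0 * y 1) (x 1 * y 0) -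
        dslope log (x 0 * y 0) (x 1 * y 1)) := by
  have right : ∀ {b x y : ℝ}, 0 < b → 0 < x → 0 < y →
      dslope log (x * b) (y * b) = dslope log x y / b := fun {b x y} hb hx hy => by
    rw [mul_comm x, mul_comm y, dslope_log_mul_left hb hx hy]
  simp only [Fin.sum_univ_two, dslope_log_self,
    dslope_log_mul_left (hx 0) (hy 0) (hy 1), dslope_log_mul_left (hx 1) (hy 0) (hy 1),
    dslope_log_mul_left (hx 0) (hy 1) (hy 0), dslope_log_mul_left (hx 1) (hy 1) (hy 0),
    right (hy 0) (hx 0) (hx 1), right (hy 1) (hx 0) (hx 1),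
    right (hy 0) (hx 1) (hx 0), right (hy 1) (hx 1) (hx 0),
    dslope_comm log (x 1) (x 0), dslope_comm log (y 1) (y 0),
    dslope_comm log (x 1 * y 1) (x 0 * y 0), dslope_comm log (x 1 * y 0) (x 0 * y 1),
    Complex.mul_re, hM₀, hM₁, hN₀, hN₁, hM, hN, Complex.star_def, Complex.conj_re,
    Complex.conj_im] at hopt ⊢
  -- By homogeneity, terms diagonal in the second qubit are multiples of `hopt`. For terms diagonal
  -- in the first qubit only, `hopt` trades the diagonal of `M` for its off-diagonal part, which
  -- yields the product of divided differences.
  linear_combination (1 / y 0 * (N 0 0).re + 1 / y 1 * (N 1 1).re +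
    2 * dslope log (y 0) (y 1) * (N 0 1).re) * hopt

end TwoQubit

/-! ### Elimination of the unperturbed sites. -/

section Derivative

variable {n : ℕ}

lemma prod_eq_mul_mul_prod {R : Type*} [CommMonoid R] {a b : Fin n} (hab : a ≠ b)
    (F : Fin n → R) :
    ∏ i, F i = F a * F b * ∏ i ∈ (Finset.univ.erase a).erase b, F i := by
  rw [mul_assoc, Finset.mul_prod_erase _ _ (Finset.mem_erase.2 ⟨hab.symm, Finset.mem_univ b⟩),
    Finset.mul_prod_erase _ _ (Finset.mem_univ a)]

/-- The derivative of the entropic functional at a product state in a direction that differs from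
the product state in two factors only involves these two factors. -/
lemma sum_dslope_tensorProd {a : Fin n → (Fin 1 → Fin 2) → ℝ} (ha : ∀ i j, 0 < a i j)
    {R E : Fin n → Op 1} {p q : Fin n} (hpq : p ≠ q) (hR : ∀ i, (R i).trace = 1)
    (hE : ∀ i, i ≠ p → i ≠ q → E i = Matrix.diagonal fun j => (a i j : ℂ)) :
    ∑ j, ∑ k, dslope Real.log (∏ i, a i fun _ => j i) (∏ i, a i fun _ => k i) *
        (tensorProd R k j * tensorProd E j k).re =
      ∑ j : Fin 2, ∑ k : Fin 2, ∑ j' : Fin 2, ∑ k' : Fin 2,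
        dslope Real.log ((a p fun _ => j) * a q fun _ => j') ((a p fun _ => k) * a q fun _ => k') *
        ((R p (fun _ => k) (fun _ => j) * E p (fun _ => j) (fun _ => k)) *
          (R q (fun _ => k') (fun _ => j') * E q (fun _ => j') (fun _ => k'))).re := by
  -- At unperturbed sites `E` is diagonal and its eigenvalue cancels by homogeneity. What remains is
  -- the diagonal of `R`, with total weight one.
  let M (i : Fin n) (x : Fin 2 × Fin 2) : ℂ :=
    if i = p ∨ i = q then R i (fun _ => x.2) (fun _ => x.1) * E i (fun _ => x.1) (fun _ => x.2)
    else if x.1 = x.2 then R i (fun _ => x.1) (fun _ => x.1) else 0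
  let G (x y : Fin 2 × Fin 2) : ℂ := ((dslope Real.log ((a p fun _ => x.1) * a q fun _ => y.1)
    ((a p fun _ => x.2) * a q fun _ => y.2) : ℝ) : ℂ)
  have hM : ∀ i, i ≠ p → i ≠ q → ∑ x, M i x = 1 := by
    intro i hip hiq
    rw [← hR i, Matrix.trace, sum_bits, Fintype.sum_prod_type]
    simp [M, hip, hiq]
  have hterm : ∀ f : Fin n → Fin 2 × Fin 2,
      ((dslope Real.log (∏ i, a i fun _ => (f i).1) (∏ i, a i fun _ => (f i).2) : ℝ) : ℂ) *
        (tensorProd R (fun i => (f i).2) (fun i => (f i).1) *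
          tensorProd E (fun i => (f i).1) (fun i => (f i).2)) =
      G (f p) (f q) * ∏ i, M i (f i) := by
    intro f
    rw [tensorProd_apply, tensorProd_apply, ← Finset.prod_mul_distrib,
      prod_eq_mul_mul_prod hpq (fun i => R i (fun _ => (f i).2) (fun _ => (f i).1) *
        E i (fun _ => (f i).1) (fun _ => (f i).2)), prod_eq_mul_mul_prod hpq (fun i => M i (f i))]
    have hMp : M p (f p) = R p (fun _ => (f p).2) (fun _ => (f p).1) *
        E p (fun _ => (f p).1) (fun _ => (f p).2) := if_pos (Or.inl rfl)
    have hMq : M q (f q) = R q (fun _ => (f q).2) (fun _ => (f q).1) *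
        E q (fun _ => (f q).1) (fun _ => (f q).2) := if_pos (Or.inr rfl)
    rw [hMp, hMq]
    by_cases hd : ∀ i ∈ (Finset.univ.erase p).erase q, (f i).1 = (f i).2
    · set c := ∏ i ∈ (Finset.univ.erase p).erase q, a i fun _ => (f i).1 with hc
      have hc0 : 0 < c := Finset.prod_pos fun i _ => ha i _
      have h1 : ∏ i, (a i fun _ => (f i).1) =
          c * ((a p fun _ => (f p).1) * a q fun _ => (f q).1) := by
        rw [prod_eq_mul_mul_prod hpq, mul_comm]
      have h2 : ∏ i, (a i fun _ => (f i).2) =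
          c * ((a p fun _ => (f p).2) * a q fun _ => (f q).2) := by
        rw [prod_eq_mul_mul_prod hpq, mul_comm, hc]
        congr 1
        exact Finset.prod_congr rfl fun i hi => by rw [hd i hi]
      have h3 : ∏ i ∈ (Finset.univ.erase p).erase q, (R i (fun _ => (f i).2) (fun _ => (f i).1) *
          E i (fun _ => (f i).1) (fun _ => (f i).2)) =
          (∏ i ∈ (Finset.univ.erase p).erase q, M i (f i)) * (c : ℂ) := by
        rw [hc, Complex.ofReal_prod, ← Finset.prod_mul_distrib]
        refine Finset.prod_congr rfl fun i hi => ?_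
        have hdi := hd i hi
        simp only [Finset.mem_erase, Finset.mem_univ, and_true] at hi
        have hMi : M i (f i) = R i (fun _ => (f i).1) (fun _ => (f i).1) := by
          simp [M, hi.1, hi.2, hdi]
        rw [hMi, hE i hi.2 hi.1, ← hdi, Matrix.diagonal_apply_eq]
      rw [h1, h2, h3, dslope_log_mul_left hc0 (mul_pos (ha _ _) (ha _ _))
        (mul_pos (ha _ _) (ha _ _)), Complex.ofReal_div]
      have : (c : ℂ) ≠ 0 := by exact_mod_cast hc0.ne'
      simp only [G]
      field_simp
    · push Not at hd
      obtain ⟨i, hi, hne⟩ := hd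
      rw [Finset.prod_eq_zero hi, Finset.prod_eq_zero hi]
      · simp
      · simp only [Finset.mem_erase, Finset.mem_univ, and_true] at hi
        simp [M, hi.1, hi.2, hne]
      · simp only [Finset.mem_erase, Finset.mem_univ, and_true] at hi
        rw [hE i hi.2 hi.1, Matrix.diagonal_apply_ne, mul_zero]
        exact fun h => hne (congrFun h 0)
  have hre : ∀ (r : ℝ) (z : ℂ), r * z.re = ((r : ℂ) * z).re := fun r z => by
    rw [Complex.re_ofReal_mul]
  have hL : ∑ j, ∑ k, dslope Real.log (∏ i, a i fun _ => j i) (∏ i, a i fun _ => k i) *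
        (tensorProd R k j * tensorProd E j k).re =
      (∑ f : Fin n → Fin 2 × Fin 2, G (f p) (f q) * ∏ i, M i (f i)).re := by
    simp only [hre, ← Complex.re_sum]
    congr 1
    rw [← Fintype.sum_prod_type' (f := fun j k => ((dslope Real.log (∏ i, a i fun _ => j i)
      (∏ i, a i fun _ => k i) : ℝ) : ℂ) * (tensorProd R k j * tensorProd E j k)),
      ← (Equiv.arrowProdEquivProdArrow (Fin n) (fun _ => Fin 2) (fun _ => Fin 2)).sum_comp]
    exact Finset.sum_congr rfl fun f _ => hterm f
  rw [hL, sum_mul_prod_of_sum_eq_one₂ M hpq hM G]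
  simp only [Fintype.sum_prod_type, hre, ← Complex.re_sum]
  simp [M, G]

end Derivative

/-! ### Perturbation of the product state and strict improvement. -/

section Main

variable {n : ℕ}

/-- Averaging the products with `(σ p + D, σ q + E)` and `(σ p - D, σ q - E)` cancels the terms
linear in one perturbation and keeps the bilinear one. -/
lemma tensorProd_add_mem_stabilizerStates {σ : Fin n → Op 1}
    (hσ : ∀ i, σ i ∈ stabilizerStates 1) {p q : Fin n} (hpq : p ≠ q) {D E : Op 1}
    (hD : IsFeasible (σ p) D) (hE : IsFeasible (σ q) E) :
    tensorProd σ + tensorProd (Function.update (Function.update σ p D) q E) ∈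
      stabilizerStates n := by
  let T (x y : Op 1) : Op n := tensorProd (Function.update (Function.update σ p x) q y)
  have hmem : ∀ x ∈ stabilizerStates 1, ∀ y ∈ stabilizerStates 1, T x y ∈ stabilizerStates n := by
    intro x hx y hy
    refine tensorProd_mem_stabilizerStates fun i => ?_
    by_cases hiq : i = q
    · subst hiq; rwa [Function.update_self]
    · rw [Function.update_of_ne hiq]
      by_cases hip : i = p
      · subst hip; rwa [Function.update_self]
      · rw [Function.update_of_ne hip]; exact hσ i
  have hr : ∀ x y, T x y = tensorProdUpdate (Function.update σ p x) q y := fun _ _ => rfl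
  have hl : ∀ x y, T x y = tensorProdUpdate (Function.update σ q y) p x := fun x y => by
    rw [tensorProdUpdate_apply, Function.update_comm hpq.symm]
  have hσT : tensorProd σ = T (σ p) (σ q) := by
    simp only [T, Function.update_eq_self]
  have e1 : T (σ p + D) (σ q + E) = T (σ p) (σ q) + T (σ p) E + (T D (σ q) + T D E) := by
    rw [hl, map_add, ← hl, ← hl, hr (σ p), map_add, hr D, map_add]; rfl
  have e2 : T (σ p - D) (σ q - E) = T (σ p) (σ q) - T (σ p) E - (T D (σ q) - T D E) := by
    rw [hl, map_sub, ← hl, ← hl, hr (σ p), map_sub, hr D, map_sub]; rfl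
  have := convex_stabilizerStates n (hmem _ hD.1 _ hE.1) (hmem _ hD.2 _ hE.2)
    (by norm_num : (0 : ℝ) ≤ 1 / 2) (by norm_num : (0 : ℝ) ≤ 1 / 2) (by norm_num)
  rw [e1, e2] at this
  rw [hσT]
  convert! this using 1
  change T (σ p) (σ q) + T D E = _
  module

lemma exists_lt_of_hasDerivAt_pos {f : ℝ → ℝ} {f' : ℝ} (h : HasDerivAt f f' 0) (hf' : 0 < f') :
    ∃ t : ℝ, 0 < t ∧ t < 1 ∧ f 0 < f t := by
  have h1 := (hasDerivAt_iff_tendsto_slope.1 h).eventually (lt_mem_nhds hf')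
  have h2 : ∀ᶠ t in 𝓝[>] (0 : ℝ), 0 < slope f 0 t :=
    h1.filter_mono (nhdsWithin_mono _ fun t ht => ne_of_gt ht)
  have h3 : ∀ᶠ t in 𝓝[>] (0 : ℝ), t < 1 :=
    (gt_mem_nhds (zero_lt_one' ℝ)).filter_mono nhdsWithin_le_nhds
  obtain ⟨t, ⟨ht1, ht2⟩, ht3⟩ := ((h2.and h3).and self_mem_nhdsWithin).exists
  have ht3 : 0 < t := ht3
  refine ⟨t, ht3, ht2, ?_⟩
  rw [slope_def_field, sub_zero, div_pos_iff_of_pos_right ht3] at ht1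
  linarith

lemma ereal_coe_sum {ι : Type*} (s : Finset ι) (f : ι → ℝ) :
    ((∑ i ∈ s, f i : ℝ) : EReal) = ∑ i ∈ s, (f i : EReal) := by
  classical
  induction s using Finset.induction_on with
  | empty => simp
  | insert a s ha ih => rw [Finset.sum_insert ha, Finset.sum_insert ha, EReal.coe_add, ih]

/-- If the functional `τ ↦ Tr (ρ₁ ⊗ ⋯ ⊗ ρₙ) log τ` has positive derivative at a positive definite
product state in the direction of `Δ`, then the product state is not optimal. -/
lemma relEntropyOfMagic_lt_sum {ρ U : Fin n → Op 1} {a : Fin n → (Fin 1 → Fin 2) → ℝ}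
    (hρ : ∀ i, ρ i ∈ densityMatrices 1)
    (hU : ∀ i, U i ∈ Matrix.unitaryGroup (Fin 1 → Fin 2) ℂ) (ha : ∀ i j, 0 < a i j)
    (hσ : ∀ i, spectralMatrix (U i) (a i) ∈ stabilizerStates 1) {Δ : Op n}
    (hΔ : tensorProd (fun i => spectralMatrix (U i) (a i)) + Δ ∈ stabilizerStates n) {L : ℝ}
    (hL : HasDerivAt (fun t : ℝ => (tensorProd ρ * cfc Real.log
      (tensorProd (fun i => spectralMatrix (U i) (a i)) + t • Δ)).trace.re) L 0) (hpos : 0 < L) :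
    relEntropyOfMagic (tensorProd ρ) < ∑ i, relEntropy (ρ i) (spectralMatrix (U i) (a i)) := by
  obtain ⟨t, ht0, ht1, hlt⟩ := exists_lt_of_hasDerivAt_pos hL hpos
  set σ : Op n := tensorProd fun i => spectralMatrix (U i) (a i) with hσdef
  have hσmem : σ ∈ stabilizerStates n := tensorProd_mem_stabilizerStates hσ
  have hσpos : σ.PosDef := by
    rw [hσdef, tensorProd_spectralMatrix]
    exact posDef_spectralMatrix (tensorProd_mem_unitaryGroup hU)
      fun j => Finset.prod_pos fun i _ => ha i _
  have hτpos : (σ + t • Δ).PosDef :=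
    posDef_add_smul hσpos (posSemidef_of_mem_stabilizerStates hΔ) ht0.le ht1
  have hτmem : σ + t • Δ ∈ stabilizerStates n := by
    have := convex_stabilizerStates n hσmem hΔ (by linarith : 0 ≤ 1 - t) ht0.le (by ring)
    convert! this using 1
    module
  have hsum : ((tensorProd ρ * log2 (tensorProd ρ)).trace.re -
      (tensorProd ρ * log2 σ).trace.re : ℝ) =
      ∑ i, ((ρ i * log2 (ρ i)).trace.re -
        (ρ i * log2 (spectralMatrix (U i) (a i))).trace.re) := by
    simp only [trace_mul_log2]
    rw [trace_tensorProd_mul_log_self hρ, hσdef,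
      trace_tensorProd_mul_cfc_log hU (fun i => (hρ i).2) fun i j h => absurd h (ha i j).ne',
      Finset.sum_sub_distrib, Complex.re_sum, Complex.re_sum, Finset.mul_sum, Finset.mul_sum]
  simp only [fun i => relEntropy_of_posDef (ρ i) (posDef_spectralMatrix (hU i) (ha i))]
  rw [← ereal_coe_sum, ← hsum]
  refine (iInf₂_le _ hτmem : relEntropyOfMagic _ ≤ _).trans_lt ?_
  rw [relEntropy_of_posDef _ hτpos, EReal.coe_lt_coe_iff, sub_lt_sub_iff_left, trace_mul_log2,
    trace_mul_log2]
  rw [zero_smul, add_zero] at hlt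
  exact mul_lt_mul_of_pos_left hlt (inv_pos.2 (Real.log_pos one_lt_two))

/-- The general derivative formula, reduced to the sites `p` and `q` by `sum_dslope_tensorProd` and
evaluated by `two_qubit_sum`. Stationarity is used at `p` only. -/
lemma hasDerivAt_tensorProd {ρ U : Fin n → Op 1} {a : Fin n → (Fin 1 → Fin 2) → ℝ}
    (hρ : ∀ i, ρ i ∈ densityMatrices 1)
    (hU : ∀ i, U i ∈ Matrix.unitaryGroup (Fin 1 → Fin 2) ℂ) (ha : ∀ i j, 0 < a i j)
    {p q : Fin n} (hpq : p ≠ q) {D E : Op 1}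
    (hcl : IsClosestStabilizerState (ρ p) (spectralMatrix (U p) (a p)))
    (hD : IsFeasible (spectralMatrix (U p) (a p)) D)
    (hE : E.IsHermitian) :
    HasDerivAt (fun t : ℝ => (tensorProd ρ * cfc Real.log
      (tensorProd (fun i => spectralMatrix (U i) (a i)) + t • tensorProd (Function.update
        (Function.update (fun i => spectralMatrix (U i) (a i)) p D) q E))).trace.re)
      (2 * (coherence (ρ p) (U p) D).re * (coherence (ρ q) (U q) E).re *
        (dslope Real.log ((a p fun _ => 0) * a q fun _ => 0) ((a p fun _ => 1) * a q fun _ => 1) +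
        dslope Real.log ((a p fun _ => 0) * a q fun _ => 1) ((a p fun _ => 1) * a q fun _ => 0) -
        2 * (dslope Real.log (a p fun _ => 0) (a p fun _ => 1) *
          dslope Real.log (a q fun _ => 0) (a q fun _ => 1))) +
      2 * (coherence (ρ p) (U p) D).im * (coherence (ρ q) (U q) E).im *
        (dslope Real.log ((a p fun _ => 0) * a q fun _ => 1) ((a p fun _ => 1) * a q fun _ => 0) -
        dslope Real.log ((a p fun _ => 0) * a q fun _ => 0) ((a p fun _ => 1) * a q fun _ => 1)))
      0 := by
  set F : Fin n → Op 1 := Function.update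
    (Function.update (fun i => spectralMatrix (U i) (a i)) p D) q E with hF
  have hFp : F p = D := by rw [hF, Function.update_of_ne hpq, Function.update_self]
  have hFq : F q = E := by rw [hF, Function.update_self]
  have hFo : ∀ i, i ≠ p → i ≠ q → F i = spectralMatrix (U i) (a i) := fun i hip hiq => by
    rw [hF, Function.update_of_ne hiq, Function.update_of_ne hip]
  have hFH : ∀ i, (F i).IsHermitian := by
    intro i
    by_cases hip : i = p
    · rw [hip, hFp]; exact hD.isHermitian
    · by_cases hiq : i = q
      · rw [hiq, hFq]; exact hE
      · rw [hFo i hip hiq]; exact isHermitian_spectralMatrix _ _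
  have h := hasDerivAt_trace_mul_cfc_log (tensorProd_mem_unitaryGroup hU)
    (a := fun j => ∏ i, a i fun _ => j i) (fun j => Finset.prod_pos fun i _ => ha i _) (isHermitian_tensorProd hFH)
    (tensorProd ρ)
  rw [conj_tensorProd, conj_tensorProd, sum_dslope_tensorProd ha hpq
    (fun i => by rw [trace_conj (hU i), (hρ i).2])
    (fun i hip hiq => by rw [hFo i hip hiq, conj_spectralMatrix (hU i)]), hFp, hFq] at h
  rw [tensorProd_spectralMatrix]
  convert! h using 1
  have hherm : ∀ {A B : Op 1}, A.IsHermitian → B.IsHermitian → ∀ x y : Fin 2,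
      A (fun _ => x) (fun _ => y) * B (fun _ => y) (fun _ => x) =
        star (A (fun _ => y) (fun _ => x) * B (fun _ => x) (fun _ => y)) := by
    intro A B hA hB x y
    rw [star_mul, hA.apply, hB.apply, mul_comm]
  have hreal : ∀ {A B : Op 1}, A.IsHermitian → B.IsHermitian → ∀ x : Fin 2,
      (A (fun _ => x) (fun _ => x) * B (fun _ => x) (fun _ => x)).im = 0 := fun hA hB x =>
    Complex.conj_eq_iff_im.1 (hherm hA hB x x).symm
  have hρp := isHermitian_conj (U := U p) (hρ p).1.isHermitian
  have hρq := isHermitian_conj (U := U q) (hρ q).1.isHermitian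
  have hDp := isHermitian_conj (U := U p) hD.isHermitian
  have hEq := isHermitian_conj (U := U q) hE
  have hopt := sum_eq_zero_of_isFeasible (hU p) (ha p) hcl hD
  simp only [sum_bits] at hopt
  exact (two_qubit_sum (x := fun x => a p fun _ => x) (y := fun x => a q fun _ => x)
    (fun _ => ha p _) (fun _ => ha q _)
    (M := fun x y => ((U p)ᴴ * ρ p * U p) (fun _ => y) (fun _ => x) *
      ((U p)ᴴ * D * U p) (fun _ => x) (fun _ => y))
    (N := fun x y => ((U q)ᴴ * ρ q * U q) (fun _ => y) (fun _ => x) *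
      ((U q)ᴴ * E * U q) (fun _ => x) (fun _ => y))
    (hreal hρp hDp 0) (hreal hρp hDp 1) (hherm hρp hDp 0 1)
    (hreal hρq hEq 0) (hreal hρq hEq 1) (hherm hρq hEq 0 1) hopt).symm

end Main

end Magic

theorem mainTheorem1 (n : ℕ) (ρ σ : Fin n → Magic.Op 1)
    (hρ : ∀ i, ρ i ∈ Magic.magicStates 1)
    (hσ : ∀ i, Magic.IsClosestStabilizerState (ρ i) (σ i))
    (hcomm : ∃ i j, i ≠ j ∧ ¬ Commute (ρ i) (σ i) ∧ ¬ Commute (ρ j) (σ j))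
    (hfacet : ∃ i, ¬ Commute (ρ i) (σ i) ∧
      ∃ A, Magic.IsFacet (Magic.stabilizerStates 1) A ∧ σ i ∈ intrinsicInterior ℝ A) :
    Magic.relEntropyOfMagic (Magic.tensorProd ρ) < ∑ i, Magic.relEntropyOfMagic (ρ i) := by
  open Magic in
  obtain ⟨p, hp, A, hA, hpA⟩ := hfacet
  -- Of two distinct noncommuting sites, at least one differs from the facet site `p`.
  obtain ⟨q, hpq, hq⟩ : ∃ q, p ≠ q ∧ ¬ Commute (ρ q) (σ q) := by
    obtain ⟨i, j, hij, hi, hj⟩ := hcomm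
    by_cases h : p = i
    · exact ⟨j, h ▸ hij, hj⟩
    · exact ⟨i, h, hi⟩
  choose U hU a ha h using fun i => exists_spectralMatrix_of_isClosest (hρ i) (hσ i)
  obtain rfl : σ = fun i => spectralMatrix (U i) (a i) := funext h
  simp only [← fun i => (hσ i).2]
  have hρd : ∀ i, ρ i ∈ densityMatrices 1 := fun i => (hρ i).1
  have hρH : ∀ i, (ρ i).IsHermitian := fun i => (hρd i).1.isHermitian
  obtain ⟨E, hE, hE0⟩ := exists_isFeasible_coherence_ne_zero (hρH q) (hU q) (ha q) (hσ q).1 hq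
  obtain ⟨hc₂, hc₁⟩ := dslope_log_mul_ne (ha p _) (ha p _) (ha q _) (ha q _)
    (ne_of_not_commute (hU p) hp) (ne_of_not_commute (hU q) hq)
  have hc₁ := sub_ne_zero.2 hc₁
  have hc₂ := sub_ne_zero.2 hc₂
  set c₁ := dslope Real.log ((a p fun _ => 0) * a q fun _ => 0)
    ((a p fun _ => 1) * a q fun _ => 1) + dslope Real.log ((a p fun _ => 0) * a q fun _ => 1)
    ((a p fun _ => 1) * a q fun _ => 0) - 2 * (dslope Real.log (a p fun _ => 0) (a p fun _ => 1) *
      dslope Real.log (a q fun _ => 0) (a q fun _ => 1)) with hc₁_def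
  set c₂ := dslope Real.log ((a p fun _ => 0) * a q fun _ => 1)
    ((a p fun _ => 1) * a q fun _ => 0) - dslope Real.log ((a p fun _ => 0) * a q fun _ => 0)
    ((a p fun _ => 1) * a q fun _ => 1) with hc₂_def
  set w := coherence (ρ q) (U q) E with hw
  -- This target coherence turns the derivative into `2 * ε` times a sum of two squares, not both
  -- zero because `w`, `c₁` and `c₂` are nonzero.
  obtain ⟨D, hD, ε, hε, hDz⟩ := exists_isFeasible_coherence_eq (hρH p) (hU p) hp hA hpA
    ⟨w.re * c₁, w.im * c₂⟩
  refine relEntropyOfMagic_lt_sum hρd hU ha (fun i => (hσ i).1)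
    (tensorProd_add_mem_stabilizerStates (fun i => (hσ i).1) hpq hD hE)
    (hasDerivAt_tensorProd hρd hU ha hpq (hσ p) hD hE.isHermitian) ?_
  rw [← hw, ← hc₁_def, ← hc₂_def, hDz]
  have hsum : 0 < (w.re * c₁) ^ 2 + (w.im * c₂) ^ 2 := by
    by_cases hre : w.re = 0
    · have him : w.im ≠ 0 := fun him => hE0 (Complex.ext hre him)
      have := mul_ne_zero him hc₂
      positivity
    · have := mul_ne_zero hre hc₁
      positivity
  have hval : 2 * (ε • (⟨w.re * c₁, w.im * c₂⟩ : ℂ)).re * w.re * c₁ +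
      2 * (ε • (⟨w.re * c₁, w.im * c₂⟩ : ℂ)).im * w.im * c₂ =
      2 * ε * ((w.re * c₁) ^ 2 + (w.im * c₂) ^ 2) := by
    simp only [Complex.smul_re, Complex.smul_im, smul_eq_mul]
    ring
  rw [hval]
  positivity
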